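/- A \emph{unital commutative $\ell$-monoid} is an algebra $\langle M;+,\lor,\land,0,1,-1\rangle$ such that $\langle M;\lor,\land\rangle$ is a distributive lattice, $\langle M;+,0\rangle$ is a commutative monoid, $+$ distributes over $\lor$ and $\land$, $-1+1=0$, $0\le 1$, and for every $x\in M$ there is $n\in\mathbb N$ with $n(-1)\le x\le n1$. An \emph{MV-monoidal algebra} is an algebra $\langle A;\oplus,\odot,\lor,\land,0,1\rangle$ such that $\langle A;\lor,\land\rangle$ is a distributive lattice, $\langle A;\oplus,0\rangle$ and $\langle A;\odot,1\rangle$ are commutative monoids, $\oplus$ and $\odot$ both distribute over both $\lor$ and $\land$, and for all $x,y,z\in A$ \begin{align*} (x\oplus y)\odot((x\odot y)\oplus z)&=(x\odot(y\oplus z))\oplus(y\odot z),\\ (x\odot y)\oplus((x\oplus y)\odot z)&=(x\oplus(y\odot z))\odot(y\oplus z),\\ (x\odot y)\oplus z&=((x\oplus y)\odot((x\odot y)\oplus z))\lor z,\\ (x\oplus y)\odot z&=((x\odot y)\oplus((x\oplus y)\odot z))\land z. \end{align*} A \emph{unital Abelian $\ell$-group} is an algebra $\langle G;+,\lor,\land,0,-,1\rangle$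 such that $\langle G;\lor,\land\rangle$ is a distributive lattice, $\langle G;+,0,-\rangle$ is an Abelian group, $+$ distributes over $\lor$ and $\land$, $0\le 1$, and for every $x\in G$ there is $n\in\mathbb N$ with $x\le n1$. An \emph{MV-algebra} is an algebra $\langle A;\oplus,\lnot,0\rangle$ such that $\langle A;\oplus,0\rangle$ is a commutative monoid, $\lnot 0\oplus x=\lnot 0$, $\lnot\lnot x=x$ and $\lnot(\lnot x\oplus y)\oplus y=\lnot(\lnot y\oplus x)\oplus x$; in it one defines $1:=\lnot 0$, $x\odot y:=\lnot(\lnot x\oplus\lnot y)$, $x\lor y:=(x\odot\lnot y)\oplus y$ and $x\land y:=x\odot(\lnot x\oplus y)$. Let $\mathsf{u\ell M}$, $\mathsf{MVM}$, $\mathsf{u\ell G}$ and $\mathsf{MV}$ be the categories of these four kinds of algebras, with homomorphisms. Let $\Gamma\colon\mathsf{u\ell M}\to\mathsf{MVM}$ be the functor sending $M$ to $\{x\in M\mid 0\le x\le 1\}$, with $\lor,\land,0,1$ restricted from $M$, $x\oplus y:=(x+y)\land 1$ and $x\odot y:=(x+y+(-1))\lor 0$, and sending a homomorphism to its restriction.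 Let $\Gamma_0\colon\mathsf{u\ell G}\to\mathsf{MV}$ be Mundici's functor, sending $G$ to $\{x\in G\mid 0\le x\le 1\}$ with $x\oplus y:=(x+y)\land 1$, $\lnot x:=1-x$ and $0$, and sending a homomorphism to its restriction. \textbf{Theorem.} The functor $\Gamma\colon\mathsf{u\ell M}\to\mathsf{MVM}$ is an equivalence of categories, and it restricts to Mundici's equivalence between $\mathsf{u\ell G}$ and $\mathsf{MV}$. That is: \begin{enumerate} \item $\Gamma$ is an equivalence; \item the $\{+,\lor,\land,0,1,-1\}$-reduct functor $U\colon\mathsf{u\ell G}\to\mathsf{u\ell M}$ (with $-1$ the additive inverse of $1$) is full and faithful; \item for every MV-algebra $A$, the algebra $\langle A;\oplus,\odot,\lor,\land,0,1\rangle$ is an MV-monoidal algebra, and the resulting reduct functor $V\colon\mathsf{MV}\to\mathsf{MVM}$ is full and faithful; \item $\Gamma\circ U\cong V\circ\Gamma_0$, through a natural isomorphism that is the identity on underlying sets; \item $\Gamma_0\colon\mathsf{u\ell G}\to\mathsf{MV}$ is an equivalence. \end{enumerate} -/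

import Mathlib

open CategoryTheory

universe u

/-! ### Unital commutative lattice-ordered monoids -/

/-- A unital commutative lattice-ordered monoid `⟨M; +, ∨, ∧, 0, 1, -1⟩`. The negative unit `-1`
is a constant of the signature, written `negOne`. -/
class UnitalLMonoid (M : Type u) extends DistribLattice M, AddCommMonoid M, One M where
  /-- The negative unit. -/
  negOne : M
  add_sup' : ∀ x y z : M, x + (y ⊔ z) = (x + y) ⊔ (x + z)
  add_inf' : ∀ x y z : M, x + (y ⊓ z) = (x + y) ⊓ (x + z)
  negOne_add_one : negOne + 1 = 0
  zero_le_one' : (0 : M) ≤ 1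
  bounded : ∀ x : M, ∃ n : ℕ, n • negOne ≤ x ∧ x ≤ n • (1 : M)

/-- Homomorphisms of unital commutative lattice-ordered monoids. -/
@[ext]
structure UnitalLMonoidHom (M N : Type u) [UnitalLMonoid M] [UnitalLMonoid N] where
  toFun : M → N
  map_add : ∀ x y, toFun (x + y) = toFun x + toFun y
  map_sup : ∀ x y, toFun (x ⊔ y) = toFun x ⊔ toFun y
  map_inf : ∀ x y, toFun (x ⊓ y) = toFun x ⊓ toFun y
  map_zero : toFun 0 = 0
  map_one : toFun 1 = 1
  map_negOne : toFun UnitalLMonoid.negOne = UnitalLMonoid.negOne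

/-- The objects of the category of unital commutative lattice-ordered monoids. -/
structure ULM : Type (u + 1) where
  carrier : Type u
  [str : UnitalLMonoid carrier]

attribute [instance] ULM.str

instance : Category ULM.{u} where
  Hom M N := UnitalLMonoidHom M.carrier N.carrier
  id M := ⟨fun x => x, fun _ _ => rfl, fun _ _ => rfl, fun _ _ => rfl, rfl, rfl, rfl⟩
  comp f g := ⟨fun x => g.toFun (f.toFun x),
    fun x y => by rw [f.map_add, g.map_add], fun x y => by rw [f.map_sup, g.map_sup],
    fun x y => by rw [f.map_inf, g.map_inf], by rw [f.map_zero, g.map_zero],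
    by rw [f.map_one, g.map_one], by rw [f.map_negOne, g.map_negOne]⟩

/-! ### MV-monoidal algebras -/

/-- A type with a binary operation `⊕`. -/
class OPlus (A : Type u) where
  oplus : A → A → A

/-- A type with a binary operation `⊙`. -/
class ODot (A : Type u) where
  odot : A → A → A

infixl:65 " ⊕ₘ " => OPlus.oplus
infixl:70 " ⊙ₘ " => ODot.odot

/-- Algebras (without axioms) in the signature `{⊕, ⊙, ∨, ∧, 0, 1}`; the operations `∨` and `∧`
are written `⊔` and `⊓`. -/
class MVMonoidalOps (A : Type u) extends OPlus A, ODot A, Max A, Min A, Zero A, One A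

/-- The equational axioms of MV-monoidal algebras. -/
structure IsMVMonoidal (A : Type u) [MVMonoidalOps A] : Prop where
  sup_comm : ∀ x y : A, x ⊔ y = y ⊔ x
  sup_assoc : ∀ x y z : A, (x ⊔ y) ⊔ z = x ⊔ (y ⊔ z)
  inf_comm : ∀ x y : A, x ⊓ y = y ⊓ x
  inf_assoc : ∀ x y z : A, (x ⊓ y) ⊓ z = x ⊓ (y ⊓ z)
  sup_inf_self : ∀ x y : A, x ⊔ (x ⊓ y) = x
  inf_sup_self : ∀ x y : A, x ⊓ (x ⊔ y) = x
  inf_sup_left : ∀ x y z : A, x ⊓ (y ⊔ z) = (x ⊓ y) ⊔ (x ⊓ z)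
  oplus_comm : ∀ x y : A, x ⊕ₘ y = y ⊕ₘ x
  oplus_assoc : ∀ x y z : A, (x ⊕ₘ y) ⊕ₘ z = x ⊕ₘ (y ⊕ₘ z)
  oplus_zero : ∀ x : A, x ⊕ₘ 0 = x
  odot_comm : ∀ x y : A, x ⊙ₘ y = y ⊙ₘ x
  odot_assoc : ∀ x y z : A, (x ⊙ₘ y) ⊙ₘ z = x ⊙ₘ (y ⊙ₘ z)
  odot_one : ∀ x : A, x ⊙ₘ 1 = x
  oplus_sup : ∀ x y z : A, x ⊕ₘ (y ⊔ z) = (x ⊕ₘ y) ⊔ (x ⊕ₘ z)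
  oplus_inf : ∀ x y z : A, x ⊕ₘ (y ⊓ z) = (x ⊕ₘ y) ⊓ (x ⊕ₘ z)
  odot_sup : ∀ x y z : A, x ⊙ₘ (y ⊔ z) = (x ⊙ₘ y) ⊔ (x ⊙ₘ z)
  odot_inf : ∀ x y z : A, x ⊙ₘ (y ⊓ z) = (x ⊙ₘ y) ⊓ (x ⊙ₘ z)
  ax4 : ∀ x y z : A, (x ⊕ₘ y) ⊙ₘ ((x ⊙ₘ y) ⊕ₘ z) = (x ⊙ₘ (y ⊕ₘ z)) ⊕ₘ (y ⊙ₘ z)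
  ax5 : ∀ x y z : A, (x ⊙ₘ y) ⊕ₘ ((x ⊕ₘ y) ⊙ₘ z) = (x ⊕ₘ (y ⊙ₘ z)) ⊙ₘ (y ⊕ₘ z)
  ax6 : ∀ x y z : A, (x ⊙ₘ y) ⊕ₘ z = ((x ⊕ₘ y) ⊙ₘ ((x ⊙ₘ y) ⊕ₘ z)) ⊔ z
  ax7 : ∀ x y z : A, (x ⊕ₘ y) ⊙ₘ z = ((x ⊙ₘ y) ⊕ₘ ((x ⊕ₘ y) ⊙ₘ z)) ⊓ z

/-- Homomorphisms of algebras in the signature `{⊕, ⊙, ∨, ∧, 0, 1}`. -/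
@[ext]
structure MVMonoidalHom (A B : Type u) [MVMonoidalOps A] [MVMonoidalOps B] where
  toFun : A → B
  map_oplus : ∀ x y, toFun (x ⊕ₘ y) = toFun x ⊕ₘ toFun y
  map_odot : ∀ x y, toFun (x ⊙ₘ y) = toFun x ⊙ₘ toFun y
  map_sup : ∀ x y, toFun (x ⊔ y) = toFun x ⊔ toFun y
  map_inf : ∀ x y, toFun (x ⊓ y) = toFun x ⊓ toFun y
  map_zero : toFun 0 = 0
  map_one : toFun 1 = 1

/-- The objects of the category of MV-monoidal algebras. -/
structure MVM : Type (u + 1) where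
  carrier : Type u
  [ops : MVMonoidalOps carrier]
  isMVMonoidal : IsMVMonoidal carrier

attribute [instance] MVM.ops

instance : Category MVM.{u} where
  Hom A B := MVMonoidalHom A.carrier B.carrier
  id A := ⟨fun x => x, fun _ _ => rfl, fun _ _ => rfl, fun _ _ => rfl, fun _ _ => rfl, rfl, rfl⟩
  comp f g := ⟨fun x => g.toFun (f.toFun x),
    fun x y => by rw [f.map_oplus, g.map_oplus], fun x y => by rw [f.map_odot, g.map_odot],
    fun x y => by rw [f.map_sup, g.map_sup], fun x y => by rw [f.map_inf, g.map_inf],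
    by rw [f.map_zero, g.map_zero], by rw [f.map_one, g.map_one]⟩

/-! ### The unit interval functor -/

/-- The unit interval `{x ∈ M ∣ 0 ≤ x ≤ 1}`. -/
abbrev UnitIntvl (M : Type u) [LE M] [Zero M] [One M] : Type u :=
  {x : M // 0 ≤ x ∧ x ≤ 1}

namespace UnitalLMonoid

variable {M : Type u} [UnitalLMonoid M]

instance : IsOrderedAddMonoid M where
  add_le_add_left a b h c := by
    have : (c + a) ⊔ (c + b) = c + b := by rw [← add_sup', sup_eq_right.2 h]
    rw [add_comm a c, add_comm b c]
    exact sup_eq_right.1 this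

theorem add_one_add_negOne (x : M) : x + 1 + negOne = x := by
  rw [add_assoc, add_comm 1, negOne_add_one, add_zero]

theorem negOne_le_zero : (negOne : M) ≤ 0 := by
  have := add_le_add_right (zero_le_one' (M := M)) negOne
  rwa [add_zero, negOne_add_one] at this

theorem sup_add' (x y z : M) : (x ⊔ y) + z = (x + z) ⊔ (y + z) := by
  rw [add_comm, add_sup', add_comm z, add_comm z]

theorem inf_add' (x y z : M) : (x ⊓ y) + z = (x + z) ⊓ (y + z) := by
  rw [add_comm, add_inf', add_comm z, add_comm z]

theorem inf_add_sup' (x y : M) : (x ⊓ y) + (x ⊔ y) = x + y := by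
  apply le_antisymm
  · rw [add_sup']
    refine sup_le ?_ ?_
    · rw [add_comm x y]; exact add_le_add inf_le_right le_rfl
    · exact add_le_add inf_le_left le_rfl
  · rw [inf_add']
    refine le_inf ?_ ?_
    · exact add_le_add le_rfl le_sup_right
    · rw [add_comm x y]; exact add_le_add le_rfl le_sup_left

/-- The operations on the unit interval: `∨`, `∧`, `0` and `1` are restrictions,
`x ⊕ y = (x + y) ∧ 1` and `x ⊙ y = (x + y - 1) ∨ 0`. -/
instance unitIntvlOps : MVMonoidalOps (UnitIntvl M) where
  oplus x y := ⟨(x.1 + y.1) ⊓ 1, le_inf (add_nonneg x.2.1 y.2.1) zero_le_one', inf_le_right⟩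
  odot x y := ⟨(x.1 + y.1 + negOne) ⊔ 0, le_sup_right, sup_le (by
    have h := add_le_add (add_le_add x.2.2 y.2.2) (le_refl (negOne : M))
    rwa [add_one_add_negOne] at h) zero_le_one'⟩
  max x y := ⟨x.1 ⊔ y.1, le_sup_of_le_left x.2.1, sup_le x.2.2 y.2.2⟩
  min x y := ⟨x.1 ⊓ y.1, le_inf x.2.1 y.2.1, inf_le_of_left_le x.2.2⟩
  zero := ⟨0, le_rfl, zero_le_one'⟩
  one := ⟨1, zero_le_one', le_rfl⟩

theorem val_oplus (x y : UnitIntvl M) : (x ⊕ₘ y).1 = (x.1 + y.1) ⊓ 1 := rfl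
theorem val_odot (x y : UnitIntvl M) : (x ⊙ₘ y).1 = (x.1 + y.1 + negOne) ⊔ 0 := rfl
theorem val_sup (x y : UnitIntvl M) : (x ⊔ y).1 = x.1 ⊔ y.1 := rfl
theorem val_inf (x y : UnitIntvl M) : (x ⊓ y).1 = x.1 ⊓ y.1 := rfl
theorem val_zero : (0 : UnitIntvl M).1 = 0 := rfl
theorem val_one : (1 : UnitIntvl M).1 = 1 := rfl

theorem oplus_add_odot (x y : UnitIntvl M) : (x ⊕ₘ y).1 + (x ⊙ₘ y).1 = x.1 + y.1 := by
  have h : (x ⊙ₘ y).1 = ((x.1 + y.1) ⊔ 1) + negOne := by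
    rw [val_odot, sup_add', add_comm 1, negOne_add_one]
  rw [h, val_oplus, ← add_assoc, inf_add_sup', add_one_add_negOne]

theorem odot_oplus (x y z : UnitIntvl M) :
    ((x ⊙ₘ y) ⊕ₘ z).1 = ((x.1 + y.1 + z.1 + negOne) ⊔ z.1) ⊓ 1 := by
  rw [val_oplus, val_odot, sup_add', zero_add, add_right_comm]

theorem oplus_odot (x y z : UnitIntvl M) :
    ((x ⊕ₘ y) ⊙ₘ z).1 = ((x.1 + y.1 + z.1 + negOne) ⊓ z.1) ⊔ 0 := by
  rw [val_odot, val_oplus, inf_add', inf_add', add_comm 1, add_one_add_negOne]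

theorem uoplus_comm (x y : UnitIntvl M) : x ⊕ₘ y = y ⊕ₘ x :=
  Subtype.ext (by rw [val_oplus, val_oplus, add_comm])

theorem uodot_comm (x y : UnitIntvl M) : x ⊙ₘ y = y ⊙ₘ x :=
  Subtype.ext (by rw [val_odot, val_odot, add_comm x.1])

theorem sigma_left (x y z : UnitIntvl M) :
    ((x ⊕ₘ y) ⊙ₘ ((x ⊙ₘ y) ⊕ₘ z)).1 = ((x.1 + y.1 + z.1 + negOne) ⊔ 0) ⊓ 1 := by
  have h1 : x.1 + y.1 + z.1 + negOne ≤ x.1 + y.1 := by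
    have := add_le_add (add_le_add (le_refl (x.1 + y.1)) z.2.2) (le_refl (negOne : M))
    rwa [add_one_add_negOne] at this
  rw [uodot_comm, uoplus_comm (x ⊙ₘ y), oplus_odot, add_assoc z.1, add_comm (x ⊙ₘ y).1,
    oplus_add_odot, add_comm z.1, val_oplus, ← inf_assoc, inf_eq_left.2 h1, sup_inf_right,
    sup_eq_left.2 (zero_le_one' (M := M))]

theorem sigma_right (x y z : UnitIntvl M) :
    ((x ⊙ₘ y) ⊕ₘ ((x ⊕ₘ y) ⊙ₘ z)).1 = ((x.1 + y.1 + z.1 + negOne) ⊔ 0) ⊓ 1 := by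
  have h1 : x.1 + y.1 + negOne ≤ x.1 + y.1 + z.1 + negOne :=
    add_le_add (le_add_of_nonneg_right z.2.1) le_rfl
  rw [uoplus_comm, uodot_comm (x ⊕ₘ y), odot_oplus, add_assoc z.1,
    oplus_add_odot, add_comm z.1, val_odot, ← sup_assoc, sup_eq_left.2 h1]

theorem isMVMonoidal_unitIntvl : IsMVMonoidal (UnitIntvl M) where
  sup_comm x y := Subtype.ext (sup_comm x.1 y.1)
  sup_assoc x y z := Subtype.ext (sup_assoc x.1 y.1 z.1)
  inf_comm x y := Subtype.ext (inf_comm x.1 y.1)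
  inf_assoc x y z := Subtype.ext (inf_assoc x.1 y.1 z.1)
  sup_inf_self x y := Subtype.ext (sup_inf_self (a := x.1) (b := y.1))
  inf_sup_self x y := Subtype.ext (inf_sup_self (a := x.1) (b := y.1))
  inf_sup_left x y z := Subtype.ext (inf_sup_left x.1 y.1 z.1)
  oplus_comm := uoplus_comm
  oplus_assoc x y z := Subtype.ext (by
    have h1 : (1 : M) ≤ 1 + z.1 := le_add_of_nonneg_right z.2.1
    have h2 : (1 : M) ≤ x.1 + 1 := le_add_of_nonneg_left x.2.1
    simp only [val_oplus]
    rw [inf_add', add_inf', inf_assoc, inf_assoc, inf_eq_right.2 h1, inf_eq_right.2 h2, add_assoc])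
  oplus_zero x := Subtype.ext (by
    rw [val_oplus, val_zero, add_zero, inf_eq_left.2 x.2.2])
  odot_comm := uodot_comm
  odot_assoc x y z := Subtype.ext (by
    have h1 : z.1 + negOne ≤ 0 := by
      have := add_le_add z.2.2 (le_refl (negOne : M))
      rwa [add_comm 1, negOne_add_one] at this
    have h2 : x.1 + negOne ≤ 0 := by
      have := add_le_add x.2.2 (le_refl (negOne : M))
      rwa [add_comm 1, negOne_add_one] at this
    simp only [val_odot]
    rw [sup_add', sup_add', add_sup', sup_add', sup_assoc, sup_assoc, zero_add, add_zero,
      sup_eq_right.2 h1, sup_eq_right.2 h2]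
    congr 2
    abel)
  odot_one x := Subtype.ext (by
    rw [val_odot, val_one, add_one_add_negOne, sup_eq_left.2 x.2.1])
  oplus_sup x y z := Subtype.ext (by
    simp only [val_oplus, val_sup]; rw [add_sup', inf_sup_right])
  oplus_inf x y z := Subtype.ext (by
    simp only [val_oplus, val_inf]; rw [add_inf', inf_inf_distrib_right])
  odot_sup x y z := Subtype.ext (by
    simp only [val_odot, val_sup]; rw [add_sup', sup_add', sup_sup_distrib_right])
  odot_inf x y z := Subtype.ext (by
    simp only [val_odot, val_inf]; rw [add_inf', inf_add', sup_inf_right])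
  ax4 x y z := Subtype.ext (by
    rw [sigma_left, uoplus_comm, uodot_comm x, uoplus_comm y, uodot_comm y, uoplus_comm z,
      uodot_comm z, uoplus_comm y, uodot_comm y, uoplus_comm z, uodot_comm z, sigma_right,
      add_comm (y.1 + z.1), add_assoc x.1])
  ax5 x y z := Subtype.ext (by
    rw [sigma_right, uodot_comm, uoplus_comm x, sigma_left, add_comm (y.1 + z.1), add_assoc x.1])
  ax6 x y z := Subtype.ext (by
    rw [val_sup, sigma_left, odot_oplus, sup_inf_right, sup_assoc, sup_eq_right.2 z.2.1,
      sup_eq_left.2 z.2.2])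
  ax7 x y z := Subtype.ext (by
    rw [val_inf, sigma_right, oplus_odot, inf_assoc, inf_eq_right.2 z.2.2, inf_sup_right,
      inf_eq_left.2 z.2.1])

end UnitalLMonoid

/-- The restriction of a homomorphism of unital commutative lattice-ordered monoids to the unit
intervals. -/
def UnitalLMonoidHom.restrict {M N : Type u} [UnitalLMonoid M] [UnitalLMonoid N]
    (f : UnitalLMonoidHom M N) : MVMonoidalHom (UnitIntvl M) (UnitIntvl N) where
  toFun x := ⟨f.toFun x.1, by
    have h := f.map_sup 0 x.1
    rw [sup_eq_right.2 x.2.1, f.map_zero] at h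
    exact sup_eq_right.1 h.symm, by
    have h := f.map_sup x.1 1
    rw [sup_eq_right.2 x.2.2, f.map_one] at h
    exact sup_eq_right.1 h.symm⟩
  map_oplus x y := Subtype.ext (by
    change f.toFun ((x.1 + y.1) ⊓ 1) = (f.toFun x.1 + f.toFun y.1) ⊓ 1
    rw [f.map_inf, f.map_add, f.map_one])
  map_odot x y := Subtype.ext (by
    change f.toFun ((x.1 + y.1 + UnitalLMonoid.negOne) ⊔ 0) =
      (f.toFun x.1 + f.toFun y.1 + UnitalLMonoid.negOne) ⊔ 0
    rw [f.map_sup, f.map_add, f.map_add, f.map_zero, f.map_negOne])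
  map_sup x y := Subtype.ext (f.map_sup x.1 y.1)
  map_inf x y := Subtype.ext (f.map_inf x.1 y.1)
  map_zero := Subtype.ext f.map_zero
  map_one := Subtype.ext f.map_one

/-- The unit interval functor `Γ` from unital commutative lattice-ordered monoids to MV-monoidal
algebras. -/
def unitIntvlFunctor : ULM.{u} ⥤ MVM.{u} where
  obj M := ⟨UnitIntvl M.carrier, UnitalLMonoid.isMVMonoidal_unitIntvl⟩
  map f := UnitalLMonoidHom.restrict f
  map_id _ := rfl
  map_comp _ _ := rfl

/-! ### Unital Abelian lattice-ordered groups -/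

/-- A unital Abelian lattice-ordered group `⟨G; +, ∨, ∧, 0, -, 1⟩`. -/
class UnitalLGroup (G : Type u) extends DistribLattice G, AddCommGroup G, One G where
  add_sup' : ∀ x y z : G, x + (y ⊔ z) = (x + y) ⊔ (x + z)
  add_inf' : ∀ x y z : G, x + (y ⊓ z) = (x + y) ⊓ (x + z)
  zero_le_one' : (0 : G) ≤ 1
  bounded : ∀ x : G, ∃ n : ℕ, x ≤ n • (1 : G)

/-- Homomorphisms of unital Abelian lattice-ordered groups. -/
@[ext]
structure UnitalLGroupHom (G H : Type u) [UnitalLGroup G] [UnitalLGroup H] where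
  toFun : G → H
  map_add : ∀ x y, toFun (x + y) = toFun x + toFun y
  map_sup : ∀ x y, toFun (x ⊔ y) = toFun x ⊔ toFun y
  map_inf : ∀ x y, toFun (x ⊓ y) = toFun x ⊓ toFun y
  map_zero : toFun 0 = 0
  map_neg : ∀ x, toFun (-x) = -toFun x
  map_one : toFun 1 = 1

/-- The objects of the category of unital Abelian lattice-ordered groups. -/
structure ULG : Type (u + 1) where
  carrier : Type u
  [str : UnitalLGroup carrier]

attribute [instance] ULG.str

instance : Category ULG.{u} where
  Hom G H := UnitalLGroupHom G.carrier H.carrier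
  id G := ⟨fun x => x, fun _ _ => rfl, fun _ _ => rfl, fun _ _ => rfl, rfl, fun _ => rfl, rfl⟩
  comp f g := ⟨fun x => g.toFun (f.toFun x),
    fun x y => by rw [f.map_add, g.map_add], fun x y => by rw [f.map_sup, g.map_sup],
    fun x y => by rw [f.map_inf, g.map_inf], by rw [f.map_zero, g.map_zero],
    fun x => by rw [f.map_neg, g.map_neg], by rw [f.map_one, g.map_one]⟩

instance UnitalLGroup.isOrderedAddMonoid {G : Type u} [UnitalLGroup G] : IsOrderedAddMonoid G where
  add_le_add_left a b h c := by
    have : (c + a) ⊔ (c + b) = c + b := by rw [← UnitalLGroup.add_sup', sup_eq_right.2 h]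
    rw [add_comm a c, add_comm b c]
    exact sup_eq_right.1 this

/-- The `{+, ∨, ∧, 0, 1, -1}`-reduct of a unital Abelian lattice-ordered group. -/
@[reducible]
def UnitalLGroup.toUnitalLMonoid (G : Type u) [UnitalLGroup G] : UnitalLMonoid G where
  negOne := -1
  add_sup' := UnitalLGroup.add_sup'
  add_inf' := UnitalLGroup.add_inf'
  negOne_add_one := neg_add_cancel 1
  zero_le_one' := UnitalLGroup.zero_le_one'
  bounded x := by
    obtain ⟨n, hn⟩ := UnitalLGroup.bounded x
    obtain ⟨m, hm⟩ := UnitalLGroup.bounded (-x)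
    have h0 : (0 : G) ≤ 1 := UnitalLGroup.zero_le_one'
    refine ⟨n + m, ?_, hn.trans (nsmul_le_nsmul_left h0 (Nat.le_add_right n m))⟩
    change (n + m) • (-1 : G) ≤ x
    rw [smul_neg, neg_le]
    exact hm.trans (nsmul_le_nsmul_left h0 (Nat.le_add_left m n))

/-- The reduct functor from unital Abelian lattice-ordered groups to unital commutative
lattice-ordered monoids; it is the identity on underlying functions. -/
def ulgReduct : ULG.{u} ⥤ ULM.{u} where
  obj G := @ULM.mk G.carrier (UnitalLGroup.toUnitalLMonoid G.carrier)
  map {G H} f := @UnitalLMonoidHom.mk G.carrier H.carrier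
    (UnitalLGroup.toUnitalLMonoid G.carrier) (UnitalLGroup.toUnitalLMonoid H.carrier)
    f.toFun f.map_add f.map_sup f.map_inf f.map_zero f.map_one
    ((f.map_neg 1).trans (congrArg Neg.neg f.map_one))
  map_id _ := rfl
  map_comp _ _ := rfl

/-! ### MV-algebras -/

/-- An MV-algebra `⟨A; ⊕, ¬, 0⟩`; the negation of `x` is written `xᶜ`. -/
class MVAlgebra (A : Type u) extends OPlus A, Compl A, Zero A where
  oplus_comm : ∀ x y : A, x ⊕ₘ y = y ⊕ₘ x
  oplus_assoc : ∀ x y z : A, (x ⊕ₘ y) ⊕ₘ z = x ⊕ₘ (y ⊕ₘ z)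
  oplus_zero : ∀ x : A, x ⊕ₘ 0 = x
  compl_zero_oplus : ∀ x : A, (0 : A)ᶜ ⊕ₘ x = 0ᶜ
  compl_compl' : ∀ x : A, xᶜᶜ = x
  lukasiewicz : ∀ x y : A, (xᶜ ⊕ₘ y)ᶜ ⊕ₘ y = (yᶜ ⊕ₘ x)ᶜ ⊕ₘ x

/-- Homomorphisms of MV-algebras. -/
@[ext]
structure MVAlgebraHom (A B : Type u) [MVAlgebra A] [MVAlgebra B] where
  toFun : A → B
  map_oplus : ∀ x y, toFun (x ⊕ₘ y) = toFun x ⊕ₘ toFun y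
  map_compl : ∀ x, toFun xᶜ = (toFun x)ᶜ
  map_zero : toFun 0 = 0

/-- The objects of the category of MV-algebras. -/
structure MV : Type (u + 1) where
  carrier : Type u
  [str : MVAlgebra carrier]

attribute [instance] MV.str

instance : Category MV.{u} where
  Hom A B := MVAlgebraHom A.carrier B.carrier
  id A := ⟨fun x => x, fun _ _ => rfl, fun _ => rfl, rfl⟩
  comp f g := ⟨fun x => g.toFun (f.toFun x),
    fun x y => by rw [f.map_oplus, g.map_oplus], fun x => by rw [f.map_compl, g.map_compl],
    by rw [f.map_zero, g.map_zero]⟩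

/-- The operations of the signature `{⊕, ⊙, ∨, ∧, 0, 1}` that are derived in an MV-algebra:
`1 = ¬0`, `x ⊙ y = ¬(¬x ⊕ ¬y)`, `x ∨ y = (x ⊙ ¬y) ⊕ y` and `x ∧ y = x ⊙ (¬x ⊕ y)`. -/
@[reducible]
def MVAlgebra.derivedOps (A : Type u) [MVAlgebra A] : MVMonoidalOps A :=
  let dot : A → A → A := fun x y => (xᶜ ⊕ₘ yᶜ)ᶜ
  { oplus := fun x y => x ⊕ₘ y
    odot := dot
    max := fun x y => dot x yᶜ ⊕ₘ y
    min := fun x y => dot x (xᶜ ⊕ₘ y)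
    zero := 0
    one := 0ᶜ }

/-- The assertion that the reduct `⟨A; ⊕, ⊙, ∨, ∧, 0, 1⟩` of an MV-algebra is an MV-monoidal
algebra. -/
def MVAlgebra.ReductIsMVMonoidal (A : Type u) [MVAlgebra A] : Prop :=
  @IsMVMonoidal A (MVAlgebra.derivedOps A)

/-- The reduct functor from MV-algebras to MV-monoidal algebras, available once the reducts are
known to be MV-monoidal algebras; it is the identity on underlying functions. -/
def mvReduct (h : ∀ A : MV.{u}, MVAlgebra.ReductIsMVMonoidal A.carrier) : MV.{u} ⥤ MVM.{u} where
  obj A := @MVM.mk A.carrier (MVAlgebra.derivedOps A.carrier) (h A)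
  map {A B} f := @MVMonoidalHom.mk A.carrier B.carrier
    (MVAlgebra.derivedOps A.carrier) (MVAlgebra.derivedOps B.carrier) f.toFun
    f.map_oplus
    (fun x y => by
      change f.toFun (xᶜ ⊕ₘ yᶜ)ᶜ = ((f.toFun x)ᶜ ⊕ₘ (f.toFun y)ᶜ)ᶜ
      simp only [f.map_oplus, f.map_compl])
    (fun x y => by
      change f.toFun ((xᶜ ⊕ₘ yᶜᶜ)ᶜ ⊕ₘ y) = ((f.toFun x)ᶜ ⊕ₘ (f.toFun y)ᶜᶜ)ᶜ ⊕ₘ f.toFun y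
      simp only [f.map_oplus, f.map_compl])
    (fun x y => by
      change f.toFun (xᶜ ⊕ₘ (xᶜ ⊕ₘ y)ᶜ)ᶜ = ((f.toFun x)ᶜ ⊕ₘ ((f.toFun x)ᶜ ⊕ₘ f.toFun y)ᶜ)ᶜ
      simp only [f.map_oplus, f.map_compl])
    f.map_zero
    ((f.map_compl 0).trans (congrArg _ f.map_zero))
  map_id _ := rfl
  map_comp _ _ := rfl

/-! ### The functor of Mundici -/

namespace UnitalLGroup

variable {G : Type u} [UnitalLGroup G]

theorem lukasiewicz_eq_sup {x y : G} (hx : x ≤ 1) (hy1 : y ≤ 1) :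
    ((1 - (((1 - x) + y) ⊓ 1)) + y) ⊓ 1 = x ⊔ y := by
  have h1 : (1 - (((1 - x) + y) ⊓ 1)) + y = x ⊔ y := by
    have e : ∀ a b : G, 1 - (a ⊓ b) = (1 - a) ⊔ (1 - b) := fun a b => by
      rw [sub_eq_add_neg, neg_inf, UnitalLGroup.add_sup', ← sub_eq_add_neg, ← sub_eq_add_neg]
    rw [e, add_comm, UnitalLGroup.add_sup']
    congr 1 <;> abel
  rw [h1, inf_eq_left.2 (sup_le hx hy1)]

/-- The MV-algebra on the unit interval of a unital Abelian lattice-ordered group, with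
`x ⊕ y = (x + y) ∧ 1` and `¬x = 1 - x`. -/
instance unitIntvlMV : MVAlgebra (UnitIntvl G) where
  oplus x y := ⟨(x.1 + y.1) ⊓ 1, le_inf (add_nonneg x.2.1 y.2.1) zero_le_one', inf_le_right⟩
  compl x := ⟨1 - x.1, sub_nonneg.2 x.2.2, sub_le_self 1 x.2.1⟩
  zero := ⟨0, le_rfl, zero_le_one'⟩
  oplus_comm x y := Subtype.ext (congrArg (· ⊓ 1) (add_comm x.1 y.1))
  oplus_assoc x y z := Subtype.ext (by
    have h1 : (1 : G) ≤ 1 + z.1 := le_add_of_nonneg_right z.2.1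
    have h2 : (1 : G) ≤ x.1 + 1 := le_add_of_nonneg_left x.2.1
    change ((x.1 + y.1) ⊓ 1 + z.1) ⊓ 1 = (x.1 + (y.1 + z.1) ⊓ 1) ⊓ 1
    rw [add_comm, UnitalLGroup.add_inf', UnitalLGroup.add_inf', add_comm z.1 1, inf_assoc,
      inf_assoc, inf_eq_right.2 h1, inf_eq_right.2 h2, add_comm z.1, add_assoc])
  oplus_zero x := Subtype.ext (by
    change (x.1 + 0) ⊓ 1 = x.1
    rw [add_zero, inf_eq_left.2 x.2.2])
  compl_zero_oplus x := Subtype.ext (by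
    change ((1 - 0) + x.1) ⊓ 1 = 1 - 0
    rw [sub_zero, inf_eq_right.2 (le_add_of_nonneg_right x.2.1)])
  compl_compl' x := Subtype.ext (sub_sub_cancel 1 x.1)
  lukasiewicz x y := Subtype.ext (by
    change ((1 - (((1 - x.1) + y.1) ⊓ 1)) + y.1) ⊓ 1 = ((1 - (((1 - y.1) + x.1) ⊓ 1)) + x.1) ⊓ 1
    rw [lukasiewicz_eq_sup x.2.2 y.2.2, lukasiewicz_eq_sup y.2.2 x.2.2, sup_comm])

end UnitalLGroup

/-- The restriction of a homomorphism of unital Abelian lattice-ordered groups to the unit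
intervals. -/
def UnitalLGroupHom.restrict {G H : Type u} [UnitalLGroup G] [UnitalLGroup H]
    (f : UnitalLGroupHom G H) : MVAlgebraHom (UnitIntvl G) (UnitIntvl H) where
  toFun x := ⟨f.toFun x.1, by
    have h := f.map_sup 0 x.1
    rw [sup_eq_right.2 x.2.1, f.map_zero] at h
    exact sup_eq_right.1 h.symm, by
    have h := f.map_sup x.1 1
    rw [sup_eq_right.2 x.2.2, f.map_one] at h
    exact sup_eq_right.1 h.symm⟩
  map_oplus x y := Subtype.ext (by
    change f.toFun ((x.1 + y.1) ⊓ 1) = (f.toFun x.1 + f.toFun y.1) ⊓ 1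
    rw [f.map_inf, f.map_add, f.map_one])
  map_compl x := Subtype.ext (by
    change f.toFun (1 - x.1) = 1 - f.toFun x.1
    rw [sub_eq_add_neg, f.map_add, f.map_neg, f.map_one, sub_eq_add_neg])
  map_zero := Subtype.ext f.map_zero

/-- Mundici's functor, sending a unital Abelian lattice-ordered group to the MV-algebra on its unit
interval and a homomorphism to its restriction. -/
def mundiciFunctor : ULG.{u} ⥤ MV.{u} where
  obj G := ⟨UnitIntvl G.carrier⟩
  map f := UnitalLGroupHom.restrict f
  map_id _ := rfl
  map_comp _ _ := rfl

/-!
Why `Γ` is an equivalence. For essential surjectivity, let `A` be an MV-monoidal algebra. The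
monoid `M` with `Γ M ≅ A` consists of the good `ℤ`-sequences of `A` (`GoodSeq`), the component at
`k` of the sequence of `x` being `((x - k) ∨ 0) ∧ 1`; they form a sublattice of `ℤ → A`. Only the
addition of a single element `a` of `A` is defined by a formula on components,
`(x + a)_k = (x_{k-1} ⊙ a) ⊕ x_k` (`GoodSeq.translate`). These translations, together with the
shift, which adds `-1`, are commuting lattice endomorphisms: they commute because the truncated sum
`((x + y + z - 1) ∨ 0) ∧ 1` is a symmetric term of `A` (`truncSum_rotate`), and they preserve `∨`
and `∧` by the axioms `ax6` and `ax7` (`IsGood.step_sup`, `IsGood.step_inf`). Every good sequence is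
the image of `0` under a composite of translations (`GoodSeq.exists_isTranslation`), and by
commutativity this composite is determined as a map by the image of `0`
(`GoodSeq.IsTranslation.ext_zero`). So evaluation at `0` is a bijection from the commutative monoid
of these composites to the set of good sequences, and transporting composition along it gives the
addition; all laws of `+` are then laws of composition, and no formula for the sum of two sequences
is needed.

For full faithfulness, `M` is generated by its unit interval and `-1`
(`UnitalLMonoid.induction_add`), and an element is determined by the truncations of its integer
translates (`UnitalLMonoid.eq_of_slice_eq`). A homomorphism `g` of unit intervals is extended by the
relation "all truncations of `y` are the images under `g` of those of `x`", which is functional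
by the second fact, total by the first, and compatible with all operations.

For an MV-algebra the axioms `ax4` to `ax7` are derived from residuation and prelinearity. The
element `t = (x ⊙ y) ⊕ ((x ⊕ y) ⊙ z)` satisfies `t ∨ z = (x ⊙ y) ⊕ z` and `t ∧ z = (x ⊕ y) ⊙ z`,
which determine it in a distributive lattice; the element obtained by permuting `x, y, z` cyclically
satisfies the same equations, whence its symmetry (`MVAlgebra.odot_oplus_rotate`).

Mundici's equivalence follows formally. Both reduct functors are fully faithful, so `Γ₀` is fully
faithful by the natural isomorphism `Γ ∘ U ≅ V ∘ Γ₀`. If `Γ M` is the reduct of an MV-algebra, then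
`a + ¬a = 1` for `a` in the unit interval, so the generators of `M` are invertible and `M` is the
reduct of a group (`mem_essImage_ulgReduct`).
-/

/-! ### Arithmetic of MV-monoidal algebras -/

section MVMonoidal

instance MVM.fact_isMVMonoidal (A : MVM.{u}) : Fact (IsMVMonoidal A.carrier) :=
  ⟨A.isMVMonoidal⟩

variable {A : Type u} [MVMonoidalOps A] [hA : Fact (IsMVMonoidal A)]

/-- The lattice reduct of an MV-monoidal algebra, with `x ≤ y` meaning `x ⊔ y = y`. -/
instance IsMVMonoidal.instDistribLattice : DistribLattice A :=
  letI : Lattice A := Lattice.mk' hA.out.sup_comm hA.out.sup_assoc hA.out.inf_comm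
    hA.out.inf_assoc hA.out.sup_inf_self hA.out.inf_sup_self
  DistribLattice.ofInfSupLe fun x y z => le_of_eq (hA.out.inf_sup_left x y z)

namespace IsMVMonoidal

theorem oplus_sup_left (x y z : A) : (x ⊔ y) ⊕ₘ z = (x ⊕ₘ z) ⊔ (y ⊕ₘ z) := by
  rw [hA.out.oplus_comm, hA.out.oplus_sup, hA.out.oplus_comm z, hA.out.oplus_comm z]

theorem oplus_inf_left (x y z : A) : (x ⊓ y) ⊕ₘ z = (x ⊕ₘ z) ⊓ (y ⊕ₘ z) := by
  rw [hA.out.oplus_comm, hA.out.oplus_inf, hA.out.oplus_comm z, hA.out.oplus_comm z]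

theorem odot_sup_left (x y z : A) : (x ⊔ y) ⊙ₘ z = (x ⊙ₘ z) ⊔ (y ⊙ₘ z) := by
  rw [hA.out.odot_comm, hA.out.odot_sup, hA.out.odot_comm z, hA.out.odot_comm z]

theorem odot_inf_left (x y z : A) : (x ⊓ y) ⊙ₘ z = (x ⊙ₘ z) ⊓ (y ⊙ₘ z) := by
  rw [hA.out.odot_comm, hA.out.odot_inf, hA.out.odot_comm z, hA.out.odot_comm z]

theorem zero_oplus (x : A) : 0 ⊕ₘ x = x := by
  rw [hA.out.oplus_comm, hA.out.oplus_zero]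

theorem one_odot (x : A) : 1 ⊙ₘ x = x := by
  rw [hA.out.odot_comm, hA.out.odot_one]

theorem oplus_le_oplus {x x' y y' : A} (hx : x ≤ x') (hy : y ≤ y') : x ⊕ₘ y ≤ x' ⊕ₘ y' := by
  rw [← sup_eq_right.2 hx, ← sup_eq_right.2 hy, hA.out.oplus_sup, oplus_sup_left]
  exact le_sup_of_le_left le_sup_left

theorem odot_le_odot {x x' y y' : A} (hx : x ≤ x') (hy : y ≤ y') : x ⊙ₘ y ≤ x' ⊙ₘ y' := by
  rw [← sup_eq_right.2 hx, ← sup_eq_right.2 hy, hA.out.odot_sup, odot_sup_left]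
  exact le_sup_of_le_left le_sup_left

theorem le_oplus_left (x y : A) : y ≤ x ⊕ₘ y := by
  have h := hA.out.ax6 1 x y
  rw [one_odot] at h
  rw [h]
  exact le_sup_right

theorem le_oplus_right (x y : A) : x ≤ x ⊕ₘ y := by
  rw [hA.out.oplus_comm]
  exact le_oplus_left y x

theorem odot_le_right (x y : A) : x ⊙ₘ y ≤ y := by
  have h := hA.out.ax7 0 x y
  rw [zero_oplus] at h
  rw [h]
  exact inf_le_right

theorem odot_le_left (x y : A) : x ⊙ₘ y ≤ x := by
  rw [hA.out.odot_comm]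
  exact odot_le_right y x

/-- The bounds are not among the axioms: they follow from `x ≤ x ⊕ y` and `x ⊙ y ≤ x`. -/
theorem zero_le (x : A) : 0 ≤ x := by
  have h := le_oplus_left x 0
  rwa [hA.out.oplus_zero] at h

theorem le_one (x : A) : x ≤ 1 := by
  have h := odot_le_right x 1
  rwa [hA.out.odot_one] at h

theorem oplus_one (x : A) : x ⊕ₘ 1 = 1 :=
  le_antisymm (le_one _) (le_oplus_left x 1)

theorem one_oplus (x : A) : 1 ⊕ₘ x = 1 :=
  le_antisymm (le_one _) (le_oplus_right 1 x)

theorem odot_zero (x : A) : x ⊙ₘ 0 = 0 :=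
  le_antisymm (odot_le_right x 0) (zero_le _)

theorem zero_odot (x : A) : 0 ⊙ₘ x = 0 :=
  le_antisymm (odot_le_left 0 x) (zero_le _)

/-- The truncated sum `((x + y + z - 1) ∨ 0) ∧ 1` of three elements of the unit interval,
expressed by the operations of MV-monoidal algebras. -/
def truncSum (x y z : A) : A := (x ⊕ₘ y) ⊙ₘ ((x ⊙ₘ y) ⊕ₘ z)

theorem truncSum_swap (x y z : A) : truncSum x y z = truncSum y x z := by
  rw [truncSum, truncSum, hA.out.oplus_comm x, hA.out.odot_comm x]

theorem truncSum_eq_rotate (x y z : A) :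
    truncSum x y z = (y ⊙ₘ z) ⊕ₘ ((y ⊕ₘ z) ⊙ₘ x) := by
  rw [truncSum, hA.out.ax4, hA.out.oplus_comm, hA.out.odot_comm x]

theorem odot_oplus_eq_truncSum (x y z : A) :
    (x ⊙ₘ y) ⊕ₘ ((x ⊕ₘ y) ⊙ₘ z) = truncSum y z x := by
  rw [hA.out.ax5, truncSum, hA.out.odot_comm, hA.out.oplus_comm x]

theorem truncSum_rotate (x y z : A) : truncSum x y z = truncSum y z x := by
  rw [truncSum_eq_rotate, odot_oplus_eq_truncSum, truncSum_eq_rotate, odot_oplus_eq_truncSum]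

/-- The two expressions for the truncated sum that are built from `x ⊕ y` and `x ⊙ y` agree. -/
theorem truncSum_eq (x y z : A) : truncSum x y z = (x ⊙ₘ y) ⊕ₘ ((x ⊕ₘ y) ⊙ₘ z) := by
  rw [odot_oplus_eq_truncSum, truncSum_rotate]

/-- A good pair: the model is `p = (x ∨ 0) ∧ 1` and `q = ((x - 1) ∨ 0) ∧ 1`, so that `q` can be
nonzero only where `p` is `1`. -/
structure IsGood (p q : A) : Prop where
  oplus_eq : p ⊕ₘ q = p
  odot_eq : p ⊙ₘ q = q

theorem isGood_one (q : A) : IsGood 1 q := ⟨one_oplus q, one_odot q⟩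

theorem isGood_zero (p : A) : IsGood p 0 := ⟨hA.out.oplus_zero p, odot_zero p⟩

theorem isGood_oplus_odot (x y : A) : IsGood (x ⊕ₘ y) (x ⊙ₘ y) := by
  constructor
  · have h := truncSum_rotate x y 1
    rw [truncSum_eq, hA.out.odot_one, truncSum, oplus_one, hA.out.odot_one, one_odot] at h
    rw [hA.out.oplus_comm, h, hA.out.oplus_comm]
  · have h := truncSum_rotate x y 0
    rw [truncSum, hA.out.oplus_zero, truncSum, odot_zero, hA.out.oplus_zero, zero_oplus] at h
    rw [h, hA.out.odot_comm]

namespace IsGood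

variable {p p' q q' : A}

theorem le (h : IsGood p q) : q ≤ p := by
  rw [← h.odot_eq]
  exact odot_le_left p q

theorem mono_left (h : IsGood p q) (hp : p ≤ p') : IsGood p' q := by
  refine ⟨le_antisymm ?_ (le_oplus_right p' q),
    le_antisymm (odot_le_right p' q) ?_⟩
  · have h6 := hA.out.ax6 p q p'
    rw [h.oplus_eq, h.odot_eq] at h6
    rw [hA.out.oplus_comm, h6]
    exact sup_le ((odot_le_left _ _).trans hp) le_rfl
  · calc q = p ⊙ₘ q := h.odot_eq.symm
      _ ≤ p' ⊙ₘ q := odot_le_odot hp le_rfl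

theorem mono_right (h : IsGood p q) (hq : q' ≤ q) : IsGood p q' := by
  refine ⟨le_antisymm ?_ (le_oplus_right p q'),
    le_antisymm (odot_le_right p q') ?_⟩
  · calc p ⊕ₘ q' ≤ p ⊕ₘ q := oplus_le_oplus le_rfl hq
      _ = p := h.oplus_eq
  · have h7 := hA.out.ax7 p q q'
    rw [h.oplus_eq, h.odot_eq] at h7
    rw [h7]
    exact le_inf (hq.trans (le_oplus_right _ _)) le_rfl

theorem sup (h : IsGood p q) (h' : IsGood p' q') : IsGood (p ⊔ p') (q ⊔ q') := by
  have h1 := h.mono_left (le_sup_left : p ≤ p ⊔ p')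
  have h2 := h'.mono_left (le_sup_right : p' ≤ p ⊔ p')
  constructor
  · rw [hA.out.oplus_sup, h1.oplus_eq, h2.oplus_eq, sup_idem]
  · rw [hA.out.odot_sup, h1.odot_eq, h2.odot_eq]

theorem inf (h : IsGood p q) (h' : IsGood p' q') : IsGood (p ⊓ p') (q ⊓ q') := by
  have h1 := h.mono_right (inf_le_left : q ⊓ q' ≤ q)
  have h2 := h'.mono_right (inf_le_right : q ⊓ q' ≤ q')
  constructor
  · rw [oplus_inf_left, h1.oplus_eq, h2.oplus_eq]
  · rw [odot_inf_left, h1.odot_eq, h2.odot_eq, inf_idem]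

/-- Both sides are the truncation of `p + q + a - 1`. -/
theorem odot_oplus (h : IsGood p q) (a : A) : (p ⊙ₘ a) ⊕ₘ q = p ⊙ₘ (a ⊕ₘ q) := by
  have e := truncSum_eq p q a
  rw [truncSum, h.oplus_eq, h.odot_eq] at e
  rw [hA.out.oplus_comm, ← e, hA.out.oplus_comm]

end IsGood

/-- The components of the translate of a good sequence `x` by an element `a` of the unit interval:
`step a p q` is the component of `x + a` at the index where `x` has the component `q`, preceded
by `p`. -/
def step (a p q : A) : A := (p ⊙ₘ a) ⊕ₘ q

theorem IsGood.step_eq {p q : A} (h : IsGood p q) (a : A) : step a p q = p ⊙ₘ (a ⊕ₘ q) :=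
  h.odot_oplus a

theorem IsGood.step {p q r : A} (h : IsGood p q) (h' : IsGood q r) (a : A) :
    IsGood (step a p q) (step a q r) := by
  have hc : IsGood (a ⊕ₘ q) (q ⊙ₘ a) := by
    rw [hA.out.odot_comm]
    exact isGood_oplus_odot a q
  have hr : IsGood (a ⊕ₘ q) r := h'.mono_left (le_oplus_left a q)
  have hd : IsGood p (q ⊙ₘ a) := h.mono_right (odot_le_left q a)
  have hq : IsMVMonoidal.step a q r ≤ q := by
    rw [h'.step_eq]
    exact odot_le_left _ _
  constructor
  · rw [h.step_eq, IsMVMonoidal.step, hA.out.oplus_comm (q ⊙ₘ a), ← hA.out.oplus_assoc]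
    have hr' : p ⊙ₘ (a ⊕ₘ q) ⊕ₘ r = p ⊙ₘ (a ⊕ₘ q) := by
      rw [← h.odot_oplus, hA.out.oplus_assoc, h'.oplus_eq]
    rw [hr', hd.odot_oplus, hc.oplus_eq]
  · rw [h.step_eq, hA.out.odot_assoc]
    have hc' : (a ⊕ₘ q) ⊙ₘ IsMVMonoidal.step a q r = IsMVMonoidal.step a q r := by
      rw [IsMVMonoidal.step, ← hr.odot_oplus, hc.odot_eq]
    rw [hc', (h.mono_right hq).odot_eq]

/-- Translations commute, by the symmetry of the truncated sum. -/
theorem IsGood.step_comm {p q : A} (h : IsGood p q) (a b r : A) :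
    IsMVMonoidal.step b (IsMVMonoidal.step a p q) (IsMVMonoidal.step a q r) =
      IsMVMonoidal.step a (IsMVMonoidal.step b p q) (IsMVMonoidal.step b q r) := by
  have key : ∀ a b : A, IsMVMonoidal.step b (IsMVMonoidal.step a p q) (IsMVMonoidal.step a q r) =
      (p ⊙ₘ truncSum a q b) ⊕ₘ r := fun a b => by
    have hd : IsGood p (q ⊙ₘ a) := h.mono_right (odot_le_left q a)
    rw [h.step_eq, IsMVMonoidal.step, IsMVMonoidal.step, hA.out.odot_assoc, ← hA.out.oplus_assoc,
      hd.odot_oplus, truncSum_eq, hA.out.oplus_comm (a ⊙ₘ q), hA.out.odot_comm q]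
  rw [key, key, truncSum_rotate a, truncSum_swap q, truncSum_rotate b q]

theorem IsGood.step_sup {p q p' q' : A} (h : IsGood p q) (h' : IsGood p' q') (a : A) :
    IsMVMonoidal.step a (p ⊔ p') (q ⊔ q') =
      IsMVMonoidal.step a p q ⊔ IsMVMonoidal.step a p' q' := by
  have cross : ∀ {p q p' q' : A}, IsGood p' q' →
      (p ⊙ₘ a) ⊕ₘ q' ≤ ((p ⊙ₘ a) ⊕ₘ q) ⊔ ((p' ⊙ₘ a) ⊕ₘ q') := fun {p q p' q'} h' => by
    have h6 := hA.out.ax6 p' q' (p ⊙ₘ a)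
    rw [h'.oplus_eq, h'.odot_eq] at h6
    rw [hA.out.oplus_comm, h6]
    refine sup_le (le_sup_of_le_right ?_) (le_sup_of_le_left (le_oplus_right _ _))
    rw [h'.odot_oplus, hA.out.oplus_comm q']
    exact odot_le_odot le_rfl (oplus_le_oplus (odot_le_right _ _) le_rfl)
  simp only [IsMVMonoidal.step]
  rw [odot_sup_left, hA.out.oplus_sup, oplus_sup_left, oplus_sup_left]
  refine le_antisymm (sup_le (sup_le le_sup_left ?_) (sup_le ?_ le_sup_right))
    (sup_le (le_sup_of_le_left le_sup_left) (le_sup_of_le_right le_sup_right))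
  · rw [_root_.sup_comm]
    exact cross h
  · exact cross h'

theorem IsGood.step_inf {p q p' q' : A} (h : IsGood p q) (h' : IsGood p' q') (a : A) :
    IsMVMonoidal.step a (p ⊓ p') (q ⊓ q') =
      IsMVMonoidal.step a p q ⊓ IsMVMonoidal.step a p' q' := by
  have cross : ∀ {p q p' q' : A}, IsGood p q →
      (p ⊙ₘ (a ⊕ₘ q)) ⊓ (p' ⊙ₘ (a ⊕ₘ q')) ≤ p ⊙ₘ (a ⊕ₘ q') := fun {p q p' q'} h => by
    have h7 := hA.out.ax7 p q (a ⊕ₘ q')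
    rw [h.oplus_eq, h.odot_eq] at h7
    rw [h7]
    refine le_inf (inf_le_of_left_le ?_) (inf_le_of_right_le (odot_le_right _ _))
    rw [← h.odot_oplus, hA.out.oplus_comm]
    exact oplus_le_oplus le_rfl (odot_le_odot le_rfl (le_oplus_right _ _))
  rw [(h.inf h').step_eq, h.step_eq, h'.step_eq, hA.out.oplus_inf, odot_inf_left,
    hA.out.odot_inf, hA.out.odot_inf]
  refine le_antisymm
    (le_inf (inf_le_of_left_le inf_le_left) (inf_le_of_right_le inf_le_right))
    (le_inf (le_inf inf_le_left (cross h)) (le_inf ?_ inf_le_right))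
  rw [_root_.inf_comm]
  exact cross h'

end IsMVMonoidal

end MVMonoidal

/-! ### Good sequences -/

section GoodSeq

open IsMVMonoidal

/-- The good sequences indexed by `ℤ` in an MV-monoidal algebra, as a sublattice of the product.
The component at `k` of the sequence that stands for `x` is `((x - k) ∨ 0) ∧ 1`; hence the
components are `1` far to the left and `0` far to the right. -/
def goodSequences (A : Type u) [MVMonoidalOps A] [hA : Fact (IsMVMonoidal A)] :
    Sublattice (ℤ → A) where
  carrier := {x | (∀ k, IsGood (x k) (x (k + 1))) ∧
    ∃ n : ℕ, (∀ k : ℤ, k < -n → x k = 1) ∧ ∀ k : ℤ, n ≤ k → x k = 0}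
  supClosed' := by
    rintro x ⟨hx, n, hn1, hn0⟩ y ⟨hy, m, hm1, hm0⟩
    refine ⟨fun k => (hx k).sup (hy k), n + m, fun k hk => ?_, fun k hk => ?_⟩
    · rw [Pi.sup_apply, hn1 k (by omega), hm1 k (by omega), sup_idem]
    · rw [Pi.sup_apply, hn0 k (by omega), hm0 k (by omega), sup_idem]
  infClosed' := by
    rintro x ⟨hx, n, hn1, hn0⟩ y ⟨hy, m, hm1, hm0⟩
    refine ⟨fun k => (hx k).inf (hy k), n + m, fun k hk => ?_, fun k hk => ?_⟩
    · rw [Pi.inf_apply, hn1 k (by omega), hm1 k (by omega), inf_idem]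
    · rw [Pi.inf_apply, hn0 k (by omega), hm0 k (by omega), inf_idem]

/-- The type of good sequences indexed by `ℤ` in an MV-monoidal algebra. -/
abbrev GoodSeq (A : Type u) [MVMonoidalOps A] [Fact (IsMVMonoidal A)] : Type u :=
  goodSequences A

namespace GoodSeq

variable {A : Type u} [MVMonoidalOps A] [hA : Fact (IsMVMonoidal A)]

instance : CoeFun (GoodSeq A) (fun _ => ℤ → A) := ⟨fun x => x.1⟩

@[ext]
theorem ext {x y : GoodSeq A} (h : ∀ k, x k = y k) : x = y := Subtype.ext (funext h)

theorem isGood (x : GoodSeq A) (k : ℤ) : IsGood (x k) (x (k + 1)) := x.2.1 k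

theorem isGood_pred (x : GoodSeq A) (k : ℤ) : IsGood (x (k - 1)) (x k) := by
  have h := x.isGood (k - 1)
  rwa [sub_add_cancel] at h

theorem antitone (x : GoodSeq A) : Antitone (x : ℤ → A) :=
  antitone_int_of_succ_le fun k => (x.isGood k).le

theorem isGood_of_lt (x : GoodSeq A) {k l : ℤ} (h : k < l) : IsGood (x k) (x l) :=
  (x.isGood k).mono_right (x.antitone (by omega))

theorem sup_apply (x y : GoodSeq A) (k : ℤ) : (x ⊔ y) k = x k ⊔ y k := rfl

theorem inf_apply (x y : GoodSeq A) (k : ℤ) : (x ⊓ y) k = x k ⊓ y k := rfl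

theorem le_def {x y : GoodSeq A} : x ≤ y ↔ ∀ k, x k ≤ y k := Iff.rfl

instance : Zero (GoodSeq A) where
  zero := ⟨fun k => if k < 0 then 1 else 0, fun k => by
    dsimp only
    split_ifs
    · exact isGood_one _
    · exact isGood_one _
    · omega
    · exact isGood_zero _, 0, fun k hk => if_pos (by simpa using hk),
      fun k hk => if_neg (by simpa using hk)⟩

theorem zero_apply_of_neg {k : ℤ} (h : k < 0) : (0 : GoodSeq A) k = 1 := if_pos h

theorem zero_apply_of_nonneg {k : ℤ} (h : 0 ≤ k) : (0 : GoodSeq A) k = 0 := if_neg (by omega)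

/-- Addition of an element of the unit interval to a good sequence. -/
def translate (a : A) (x : GoodSeq A) : GoodSeq A :=
  ⟨fun k => step a (x (k - 1)) (x k), fun k => by
    have h := (x.isGood_pred k).step (x.isGood k) a
    rwa [← add_sub_cancel_right k 1, sub_add_cancel] at h ⊢, by
    obtain ⟨n, h1, h0⟩ := x.2.2
    refine ⟨n + 1, fun k hk => ?_, fun k hk => ?_⟩
    · change (_ ⊕ₘ x.1 k) = 1
      rw [h1 k (by omega), oplus_one]
    · change ((x.1 (k - 1) ⊙ₘ a) ⊕ₘ x.1 k) = 0
      rw [h0 k (by omega), h0 (k - 1) (by omega), zero_odot, hA.out.oplus_zero]⟩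

theorem translate_apply (a : A) (x : GoodSeq A) (k : ℤ) :
    translate a x k = (x (k - 1) ⊙ₘ a) ⊕ₘ x k := rfl

/-- Addition of `-1` to a good sequence. -/
def shift (x : GoodSeq A) : GoodSeq A :=
  ⟨fun k => x (k + 1), fun k => x.isGood (k + 1), by
    obtain ⟨n, h1, h0⟩ := x.2.2
    exact ⟨n + 1, fun k hk => h1 _ (by omega), fun k hk => h0 _ (by omega)⟩⟩

theorem shift_apply (x : GoodSeq A) (k : ℤ) : shift x k = x (k + 1) := rfl

theorem translate_one_apply (x : GoodSeq A) (k : ℤ) : translate 1 x k = x (k - 1) := by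
  rw [translate_apply, hA.out.odot_one, (x.isGood_pred k).oplus_eq]

theorem translate_one_shift (x : GoodSeq A) : translate 1 (shift x) = x := by
  ext k
  rw [translate_one_apply, shift_apply, sub_add_cancel]

theorem translate_comm (a b : A) (x : GoodSeq A) :
    translate a (translate b x) = translate b (translate a x) := by
  ext k
  have h := (x.isGood_pred (k - 1)).step_comm b a (x k)
  exact h

theorem translate_shift (a : A) (x : GoodSeq A) :
    translate a (shift x) = shift (translate a x) := by
  ext k
  rw [translate_apply, shift_apply, shift_apply, shift_apply, translate_apply, sub_add_cancel,
    add_sub_cancel_right]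

/-- The self-maps of the set of good sequences that are composed of additions of elements of the
unit interval and of `-1`. A good sequence `x` will correspond to the only such map `f` with
`f 0 = x`, and `f y` will be the sum of `x` and `y`. -/
inductive IsTranslation : (GoodSeq A → GoodSeq A) → Prop
  | id : IsTranslation fun x => x
  | translate (a : A) {f} : IsTranslation f → IsTranslation fun x => translate a (f x)
  | shift {f} : IsTranslation f → IsTranslation fun x => shift (f x)

namespace IsTranslation

variable {f g : GoodSeq A → GoodSeq A}

theorem comp (hf : IsTranslation f) (hg : IsTranslation g) :
    IsTranslation fun x => f (g x) := by
  induction hf with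
  | id => exact hg
  | translate a _ ih => exact ih.translate a
  | shift _ ih => exact ih.shift

theorem map_translate (hf : IsTranslation f) (a : A) (x : GoodSeq A) :
    f (GoodSeq.translate a x) = GoodSeq.translate a (f x) := by
  induction hf with
  | id => rfl
  | translate b _ ih => beta_reduce; rw [ih, translate_comm]
  | shift _ ih => beta_reduce; rw [ih, translate_shift]

theorem map_shift (hf : IsTranslation f) (x : GoodSeq A) :
    f (GoodSeq.shift x) = GoodSeq.shift (f x) := by
  induction hf with
  | id => rfl
  | translate b _ ih => beta_reduce; rw [ih, translate_shift]
  | shift _ ih => beta_reduce; rw [ih]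

theorem comm (hf : IsTranslation f) (hg : IsTranslation g) (x : GoodSeq A) :
    f (g x) = g (f x) := by
  induction hg with
  | id => rfl
  | translate a _ ih => beta_reduce; rw [hf.map_translate, ih]
  | shift _ ih => beta_reduce; rw [hf.map_shift, ih]

theorem map_sup (hf : IsTranslation f) (x y : GoodSeq A) : f (x ⊔ y) = f x ⊔ f y := by
  induction hf with
  | id => rfl
  | @translate a f _ ih =>
    beta_reduce
    rw [ih]
    ext k
    exact ((f x).isGood_pred k).step_sup ((f y).isGood_pred k) a
  | shift _ ih => beta_reduce; rw [ih]; rfl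

theorem map_inf (hf : IsTranslation f) (x y : GoodSeq A) : f (x ⊓ y) = f x ⊓ f y := by
  induction hf with
  | id => rfl
  | @translate a f _ ih =>
    beta_reduce
    rw [ih]
    ext k
    exact ((f x).isGood_pred k).step_inf ((f y).isGood_pred k) a
  | shift _ ih => beta_reduce; rw [ih]; rfl

end IsTranslation

/-- A good sequence that vanishes from `n` on and is `1` at all negative indices is the sum of its
components `x 0, …, x (n - 1)`. -/
theorem exists_isTranslation_of_nonneg (n : ℕ) (x : GoodSeq A) (h1 : ∀ k < 0, x k = 1)
    (h0 : ∀ k : ℤ, n ≤ k → x k = 0) : ∃ f, IsTranslation f ∧ f 0 = x := by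
  induction n generalizing x with
  | zero =>
    refine ⟨_, .id, ?_⟩
    ext k
    rcases lt_or_ge k 0 with hk | hk
    · rw [zero_apply_of_neg hk, h1 k hk]
    · rw [zero_apply_of_nonneg hk, h0 k (by simpa using hk)]
  | succ n ih =>
    -- The truncation of `x` at `n`, that is, the sequence of `x ∧ n`.
    let y : GoodSeq A := ⟨fun k => if k < n then x k else 0, fun k => by
        dsimp only
        split_ifs
        · exact x.isGood k
        · exact isGood_zero _
        · omega
        · exact isGood_zero _,
      n, fun k hk => by
        beta_reduce
        rw [if_pos (by omega)]
        exact h1 k (by omega),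
      fun k hk => if_neg (by omega)⟩
    have hy : ∀ k : ℤ, y k = if k < n then x k else 0 := fun k => rfl
    obtain ⟨f, hf, hfy⟩ := ih y (fun k hk => by rw [hy, if_pos (by omega), h1 k hk])
      (fun k hk => by rw [hy, if_neg (by omega)])
    refine ⟨_, hf.translate (x n), ?_⟩
    ext k
    rw [hfy, translate_apply, hy, hy]
    rcases lt_trichotomy k n with hk | hk | hk
    · rw [if_pos hk, if_pos (by omega), (x.isGood_of_lt (by omega)).odot_eq, hA.out.oplus_comm,
        (x.isGood_of_lt hk).oplus_eq]
    · subst hk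
      rw [if_pos (by omega), if_neg (by omega), (x.isGood_of_lt (by omega)).odot_eq,
        hA.out.oplus_zero]
    · rw [if_neg (by omega), if_neg (by omega), zero_odot, hA.out.oplus_zero,
        h0 k (by push_cast; omega)]

theorem exists_isTranslation_of_shift (n : ℕ) (x : GoodSeq A)
    (h1 : ∀ k : ℤ, k < -n → x k = 1) : ∃ f, IsTranslation f ∧ f 0 = x := by
  induction n generalizing x with
  | zero =>
    obtain ⟨m, -, h0⟩ := x.2.2
    exact exists_isTranslation_of_nonneg m x (fun k hk => h1 k (by simpa using hk)) h0
  | succ n ih =>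
    obtain ⟨f, hf, hfx⟩ := ih (translate 1 x) (fun k hk => by
      rw [translate_one_apply, h1 _ (by push_cast; omega)])
    refine ⟨_, hf.shift, ?_⟩
    rw [hfx, ← translate_shift, translate_one_shift]

theorem exists_isTranslation (x : GoodSeq A) : ∃ f, IsTranslation f ∧ f 0 = x := by
  obtain ⟨n, h1, -⟩ := x.2.2
  exact exists_isTranslation_of_shift n x h1

/-- A translation is determined by its value at `0`, since translations commute and every good
sequence is a translate of `0`. -/
theorem IsTranslation.ext_zero {f g : GoodSeq A → GoodSeq A} (hf : IsTranslation f)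
    (hg : IsTranslation g) (h : f 0 = g 0) (x : GoodSeq A) : f x = g x := by
  obtain ⟨t, ht, rfl⟩ := exists_isTranslation x
  rw [hf.comm ht, hg.comm ht, h]

noncomputable instance : Add (GoodSeq A) where
  add x y := (exists_isTranslation x).choose y

theorem IsTranslation.add_eq {f : GoodSeq A → GoodSeq A} (hf : IsTranslation f) (x : GoodSeq A) :
    f 0 + x = f x :=
  (exists_isTranslation (f 0)).choose_spec.1.ext_zero hf
    (exists_isTranslation (f 0)).choose_spec.2 x

theorem zero_add' (x : GoodSeq A) : 0 + x = x := IsTranslation.id.add_eq x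

theorem add_comm' (x y : GoodSeq A) : x + y = y + x := by
  obtain ⟨f, hf, rfl⟩ := exists_isTranslation x
  obtain ⟨g, hg, rfl⟩ := exists_isTranslation y
  rw [hf.add_eq, hg.add_eq, hf.comm hg]

theorem add_assoc' (x y z : GoodSeq A) : x + y + z = x + (y + z) := by
  obtain ⟨f, hf, rfl⟩ := exists_isTranslation x
  obtain ⟨g, hg, rfl⟩ := exists_isTranslation y
  rw [hf.add_eq, hg.add_eq, hf.add_eq, (hf.comp hg).add_eq]

noncomputable instance : AddCommMonoid (GoodSeq A) where
  add_assoc := add_assoc'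
  zero_add := zero_add'
  add_zero x := by rw [add_comm', zero_add']
  add_comm := add_comm'
  nsmul := nsmulRec

/-- The unit of the lattice-ordered monoid of good sequences. -/
instance : One (GoodSeq A) := ⟨translate 1 0⟩

theorem translate_zero_add (a : A) (x : GoodSeq A) : translate a 0 + x = translate a x :=
  (IsTranslation.id.translate a).add_eq x

theorem one_add (x : GoodSeq A) : 1 + x = translate 1 x := translate_zero_add 1 x

theorem shift_zero_add (x : GoodSeq A) : shift 0 + x = shift x := IsTranslation.id.shift.add_eq x

theorem nsmul_one_apply (n : ℕ) (k : ℤ) : (n • (1 : GoodSeq A)) k = (0 : GoodSeq A) (k - n) := by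
  induction n generalizing k with
  | zero => rw [zero_nsmul, Nat.cast_zero, sub_zero]
  | succ n ih =>
    rw [succ_nsmul', one_add, translate_one_apply, ih]
    exact congrArg (0 : GoodSeq A).1 (by push_cast; ring)

theorem nsmul_shift_zero_apply (n : ℕ) (k : ℤ) :
    (n • shift (0 : GoodSeq A)) k = (0 : GoodSeq A) (k + n) := by
  induction n generalizing k with
  | zero => rw [zero_nsmul, Nat.cast_zero, add_zero]
  | succ n ih =>
    rw [succ_nsmul', shift_zero_add, shift_apply, ih]
    exact congrArg (0 : GoodSeq A).1 (by push_cast; ring)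

noncomputable instance : UnitalLMonoid (GoodSeq A) where
  negOne := shift 0
  add_sup' x y z := by
    obtain ⟨f, hf, rfl⟩ := exists_isTranslation x
    rw [hf.add_eq, hf.add_eq, hf.add_eq, hf.map_sup]
  add_inf' x y z := by
    obtain ⟨f, hf, rfl⟩ := exists_isTranslation x
    rw [hf.add_eq, hf.add_eq, hf.add_eq, hf.map_inf]
  negOne_add_one := by
    rw [add_comm, one_add, translate_one_shift]
  zero_le_one' := le_def.2 fun _ => le_oplus_left _ _
  bounded x := by
    obtain ⟨n, h1, h0⟩ := x.2.2
    refine ⟨n, le_def.2 fun k => ?_, le_def.2 fun k => ?_⟩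
    · rw [nsmul_shift_zero_apply]
      rcases lt_or_ge k (-n) with hk | hk
      · exact (le_one _).trans (h1 k hk).ge
      · rw [zero_apply_of_nonneg (by omega)]
        exact zero_le _
    · rw [nsmul_one_apply]
      rcases lt_or_ge k n with hk | hk
      · rw [zero_apply_of_neg (by omega)]
        exact le_one _
      · exact (h0 k hk).le.trans (zero_le _)

theorem add_negOne (x : GoodSeq A) : x + UnitalLMonoid.negOne = shift x := by
  rw [add_comm]
  exact shift_zero_add x

theorem one_apply (k : ℤ) : (1 : GoodSeq A) k = (0 : GoodSeq A) (k - 1) :=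
  translate_one_apply 0 k

theorem translate_zero_apply_zero (a : A) : translate a 0 0 = a := by
  rw [translate_apply, zero_apply_of_neg (by omega), zero_apply_of_nonneg le_rfl, one_odot,
    hA.out.oplus_zero]

theorem unitIntvl_apply_of_neg (x : UnitIntvl (GoodSeq A)) {k : ℤ} (h : k < 0) : x.1 k = 1 :=
  le_antisymm (le_one _) ((zero_apply_of_neg h).ge.trans (le_def.1 x.2.1 k))

theorem unitIntvl_apply_of_pos (x : UnitIntvl (GoodSeq A)) {k : ℤ} (h : 0 < k) : x.1 k = 0 := by
  refine le_antisymm ((le_def.1 x.2.2 k).trans ?_) (zero_le _)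
  rw [one_apply, zero_apply_of_nonneg (by omega)]

theorem unitIntvl_eq_translate (x : UnitIntvl (GoodSeq A)) : x.1 = translate (x.1 0) 0 := by
  ext k
  rcases lt_trichotomy k 0 with hk | rfl | hk
  · rw [unitIntvl_apply_of_neg x hk, translate_apply, zero_apply_of_neg hk, oplus_one]
  · rw [translate_zero_apply_zero]
  · rw [unitIntvl_apply_of_pos x hk, translate_apply, zero_apply_of_nonneg hk.le,
      zero_apply_of_nonneg (by omega), zero_odot, zero_oplus]

theorem unitIntvl_add_apply (x y : UnitIntvl (GoodSeq A)) (k : ℤ) :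
    (x.1 + y.1) k = (y.1 (k - 1) ⊙ₘ x.1 0) ⊕ₘ y.1 k := by
  rw [unitIntvl_eq_translate x, translate_zero_add, translate_apply, translate_zero_apply_zero]

/-- The component at `0`, as a homomorphism from the unit interval of the lattice-ordered monoid
of good sequences to the original algebra. -/
def unitIntvlHom (A : Type u) [MVMonoidalOps A] [hA : Fact (IsMVMonoidal A)] :
    MVMonoidalHom (UnitIntvl (GoodSeq A)) A where
  toFun x := x.1 0
  map_oplus x y := by
    rw [UnitalLMonoid.val_oplus, inf_apply, unitIntvl_add_apply, one_apply,
      zero_apply_of_neg (by omega), unitIntvl_apply_of_neg y (by omega), one_odot,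
      inf_eq_left.2 (le_one _)]
  map_odot x y := by
    rw [UnitalLMonoid.val_odot, sup_apply, zero_apply_of_nonneg le_rfl, add_negOne, shift_apply,
      unitIntvl_add_apply, unitIntvl_apply_of_pos y (k := 0 + 1) (by omega), hA.out.oplus_zero,
      sup_eq_left.2 (zero_le _), hA.out.odot_comm, zero_add, sub_self]
  map_sup x y := rfl
  map_inf x y := rfl
  map_zero := zero_apply_of_nonneg le_rfl
  map_one := translate_zero_apply_zero 1

theorem unitIntvlHom_bijective : Function.Bijective (unitIntvlHom A).toFun := by
  constructor
  · intro x y h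
    apply Subtype.ext
    rw [unitIntvl_eq_translate x, unitIntvl_eq_translate y]
    exact congrArg (fun a => translate a 0) h
  · intro a
    refine ⟨⟨translate a 0, le_def.2 fun k => le_oplus_left _ _, le_def.2 fun k => ?_⟩,
      translate_zero_apply_zero a⟩
    exact oplus_le_oplus (odot_le_odot le_rfl (le_one a)) le_rfl

end GoodSeq

end GoodSeq

/-! ### Unital lattice-ordered monoids and their unit intervals -/

section Slices

namespace UnitalLMonoid

variable {M : Type u} [UnitalLMonoid M]

theorem one_add_negOne : (1 : M) + negOne = 0 := by
  rw [add_comm, negOne_add_one]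

theorem add_negOne_sup_zero_add_inf_one (x : M) : ((x + negOne) ⊔ 0) + (x ⊓ 1) = x := by
  rw [add_comm, ← one_add_negOne, ← sup_add', ← add_assoc, inf_add_sup', add_one_add_negOne]

/-- A unital commutative lattice-ordered monoid is generated by its unit interval and `-1`. -/
theorem induction_add {P : M → Prop} (zero : P 0)
    (add : ∀ (x : M) (a : UnitIntvl M), P x → P (x + a.1))
    (add_negOne : ∀ x : M, P x → P (x + negOne)) (x : M) : P x := by
  have hpos : ∀ (n : ℕ) (x : M), 0 ≤ x → x ≤ n • (1 : M) → P x := by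
    intro n
    induction n with
    | zero =>
      intro x h0 h1
      rw [zero_nsmul] at h1
      rwa [le_antisymm h1 h0]
    | succ n ih =>
      intro x h0 h1
      rw [← add_negOne_sup_zero_add_inf_one x]
      refine add _ ⟨x ⊓ 1, le_inf h0 zero_le_one', inf_le_right⟩
        (ih _ le_sup_right (sup_le ?_ (nsmul_nonneg zero_le_one' n)))
      rw [succ_nsmul] at h1
      have h := add_le_add h1 (le_refl (negOne : M))
      rwa [add_one_add_negOne] at h
  have hneg : ∀ (n : ℕ) (x : M), P (x + n • (1 : M)) → P x := by
    intro n
    induction n with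
    | zero =>
      intro x h
      rwa [zero_nsmul, add_zero] at h
    | succ n ih =>
      intro x h
      refine ih x ?_
      have h' := add_negOne _ h
      rwa [succ_nsmul, ← add_assoc, add_one_add_negOne] at h'
  obtain ⟨n, h1, h2⟩ := bounded x
  have hn : n • (negOne : M) + n • (1 : M) = 0 := by
    rw [← nsmul_add, negOne_add_one, nsmul_zero]
  refine hneg n x (hpos (n + n) _ ?_ ?_)
  · rw [← hn]
    exact add_le_add h1 le_rfl
  · rw [add_nsmul]
    exact add_le_add h2 le_rfl

/-- The unit as an additively invertible element, with inverse `-1`. -/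
def unitElt (M : Type u) [UnitalLMonoid M] : AddUnits M :=
  ⟨1, negOne, one_add_negOne, negOne_add_one⟩

/-- The integer multiple `k1` of the unit. -/
def intElt (M : Type u) [UnitalLMonoid M] (k : ℤ) : M := (k • unitElt M : AddUnits M)

theorem intElt_zero : intElt M 0 = 0 := by
  rw [intElt, zero_zsmul, AddUnits.val_zero]

theorem intElt_add_one (k : ℤ) : intElt M (k + 1) = intElt M k + 1 := by
  rw [intElt, add_one_zsmul, AddUnits.val_add]
  rfl

theorem intElt_sub_one (k : ℤ) : intElt M (k - 1) = intElt M k + negOne := by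
  have h := intElt_add_one (M := M) (k - 1)
  rw [sub_add_cancel] at h
  rw [h, add_one_add_negOne]

theorem intElt_nonpos (n : ℕ) : intElt M (-n) ≤ 0 := by
  induction n with
  | zero => rw [Nat.cast_zero, neg_zero, intElt_zero]
  | succ n ih =>
    have h : (-((n + 1 : ℕ) : ℤ)) = -n - 1 := by push_cast; ring
    rw [h, intElt_sub_one, ← add_zero (0 : M)]
    exact add_le_add ih negOne_le_zero

theorem one_le_intElt (n : ℕ) : 1 ≤ intElt M (n + 1) := by
  rw [intElt_add_one]
  refine le_add_of_nonneg_left ?_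
  induction n with
  | zero => rw [Nat.cast_zero, intElt_zero]
  | succ n ih =>
    rw [Nat.cast_succ, intElt_add_one]
    exact add_nonneg ih zero_le_one'

/-- The truncation `(x ∨ 0) ∧ 1` of an element to the unit interval. -/
def slice (x : M) : UnitIntvl M :=
  ⟨(x ⊔ 0) ⊓ 1, le_inf le_sup_right zero_le_one', inf_le_right⟩

theorem slice_val (x : M) : (slice x).1 = (x ⊔ 0) ⊓ 1 := rfl

theorem slice_sup (x y : M) : slice (x ⊔ y) = slice x ⊔ slice y := by
  apply Subtype.ext
  rw [val_sup, slice_val, slice_val, slice_val, ← inf_sup_right, sup_sup_distrib_right]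

theorem slice_inf (x y : M) : slice (x ⊓ y) = slice x ⊓ slice y := by
  apply Subtype.ext
  rw [val_inf, slice_val, slice_val, slice_val, ← inf_inf_distrib_right, sup_inf_right]

theorem slice_eq_one {x : M} (h : 1 ≤ x) : slice x = 1 := by
  apply Subtype.ext
  rw [slice_val, inf_eq_right.2 (h.trans le_sup_left), val_one]

theorem slice_eq_zero {x : M} (h : x ≤ 0) : slice x = 0 := by
  apply Subtype.ext
  rw [slice_val, sup_eq_right.2 h, inf_eq_left.2 zero_le_one', val_zero]

/-- The truncations of `x + a` are computed from those of `x` by the operations of MV-monoidal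
algebras. -/
theorem slice_add (x : M) (a : UnitIntvl M) :
    slice (x + a.1) = (slice (x + 1) ⊙ₘ a) ⊕ₘ slice x := by
  apply Subtype.ext
  have ha : a.1 + negOne ≤ 0 := by
    have h := add_le_add a.2.2 (le_refl (negOne : M))
    rwa [one_add_negOne] at h
  have hx : x ≤ x + a.1 := le_add_of_nonneg_right a.2.1
  have h1 : (slice (x + 1) ⊙ₘ a).1 = ((x ⊓ 0) + a.1) ⊔ 0 := by
    rw [val_odot, slice_val, add_assoc, inf_add', sup_add', zero_add]
    have e1 : x + 1 + (a.1 + negOne) = x + a.1 := by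
      rw [add_add_add_comm, one_add_negOne, add_zero]
    have e2 : 1 + (a.1 + negOne) = a.1 := by
      rw [add_left_comm, one_add_negOne, add_zero]
    rw [e1, e2, inf_add', zero_add, sup_inf_right, sup_assoc, sup_eq_right.2 ha, ← sup_inf_right]
  rw [val_oplus, h1, slice_val, slice_val, add_inf', inf_assoc,
    inf_eq_right.2 (le_add_of_nonneg_left le_sup_right : (1 : M) ≤ _ + 1), sup_add', zero_add,
    add_right_comm, inf_add_sup', add_zero, ← sup_assoc, sup_eq_left.2 hx]

/-- An element is determined by the truncations of its translates by integers. -/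
theorem eq_of_slice_eq {x y : M}
    (h : ∀ k : ℤ, slice (x + intElt M k) = slice (y + intElt M k)) : x = y := by
  have hpos : ∀ (n : ℕ) (x y : M), 0 ≤ x → 0 ≤ y → x ≤ n • (1 : M) → y ≤ n • (1 : M) →
      (∀ k : ℕ, slice (x + intElt M (-k)) = slice (y + intElt M (-k))) → x = y := by
    intro n
    induction n with
    | zero =>
      intro x y hx hy hx' hy' _
      rw [zero_nsmul] at hx' hy'
      rw [le_antisymm hx' hx, le_antisymm hy' hy]
    | succ n ih =>
      intro x y hx hy hx' hy' h
      have hle : ∀ {z : M}, z ≤ (n + 1) • (1 : M) → (z + negOne) ⊔ 0 ≤ n • (1 : M) := by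
        intro z hz
        rw [succ_nsmul] at hz
        have hz' := add_le_add hz (le_refl (negOne : M))
        rw [add_one_add_negOne] at hz'
        exact sup_le hz' (nsmul_nonneg zero_le_one' n)
      have hslice : ∀ (z : M) (k : ℕ), slice ((z + negOne) ⊔ 0 + intElt M (-k)) =
          slice (z + intElt M (-(k + 1 : ℕ))) := by
        intro z k
        have hk : (-((k + 1 : ℕ) : ℤ)) = -k - 1 := by push_cast; ring
        have h0 : slice (0 + intElt M (-k)) = 0 := by
          rw [zero_add]
          exact slice_eq_zero (intElt_nonpos k)
        rw [sup_add', slice_sup, h0, hk, intElt_sub_one, add_right_comm, add_assoc]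
        apply Subtype.ext
        rw [val_sup, val_zero, sup_eq_left.2 (slice _).2.1]
      have h0 := congrArg Subtype.val (h 0)
      rw [Nat.cast_zero, neg_zero, intElt_zero, add_zero, add_zero, slice_val, slice_val,
        sup_eq_left.2 hx, sup_eq_left.2 hy] at h0
      rw [← add_negOne_sup_zero_add_inf_one x, ← add_negOne_sup_zero_add_inf_one y, h0,
        ih _ _ le_sup_right le_sup_right (hle hx') (hle hy') fun k => by
          rw [hslice, hslice, h (k + 1)]]
  have hneg : ∀ (n : ℕ) (x : M) (k : ℤ),
      slice (x + n • (1 : M) + intElt M k) = slice (x + intElt M (k + n)) := by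
    intro n
    induction n with
    | zero =>
      intro x k
      rw [zero_nsmul, add_zero, Nat.cast_zero, add_zero]
    | succ n ih =>
      intro x k
      have e : k + ((n + 1 : ℕ) : ℤ) = k + 1 + n := by push_cast; ring
      rw [e, ← ih, intElt_add_one, succ_nsmul, ← add_assoc, add_right_comm _ 1, add_assoc _ _ 1]
  obtain ⟨n, hx1, hx2⟩ := bounded x
  obtain ⟨m, hy1, hy2⟩ := bounded y
  have hn : ∀ n : ℕ, n • (negOne : M) + n • (1 : M) = 0 := fun n => by
    rw [← nsmul_add, negOne_add_one, nsmul_zero]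
  have hmono : ∀ i j : ℕ, i • (1 : M) ≤ (i + j) • (1 : M) := fun i j =>
    nsmul_le_nsmul_left zero_le_one' (Nat.le_add_right i j)
  have hnonneg : ∀ {z : M} {i : ℕ} (j : ℕ), i • (negOne : M) ≤ z → 0 ≤ z + (i + j) • (1 : M) := by
    intro z i j hz
    rw [← hn i]
    exact add_le_add hz (hmono i j)
  have key : x + (n + m) • (1 : M) = y + (n + m) • (1 : M) := by
    refine hpos (n + m + (n + m)) _ _ (hnonneg m hx1) ?_ ?_ ?_ fun k => ?_
    · rw [add_comm n m]
      exact hnonneg n hy1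
    · rw [add_nsmul (1 : M) (n + m)]
      exact add_le_add (hx2.trans (hmono n m)) le_rfl
    · rw [add_nsmul (1 : M) (n + m)]
      refine add_le_add (hy2.trans ?_) le_rfl
      rw [add_comm n m]
      exact hmono m n
    · rw [hneg, hneg, h]
  have hc := congrArg (· + (n + m) • (negOne : M)) key
  simpa only [add_assoc, ← nsmul_add, one_add_negOne, nsmul_zero, add_zero] using hc

variable {N : Type u} [UnitalLMonoid N]

theorem hom_ext {f g : UnitalLMonoidHom M N} (h : ∀ a : UnitIntvl M, f.toFun a.1 = g.toFun a.1) :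
    f = g := by
  apply UnitalLMonoidHom.ext
  funext x
  induction x using induction_add with
  | zero => rw [f.map_zero, g.map_zero]
  | add x a ih => rw [f.map_add, g.map_add, ih, h]
  | add_negOne x ih => rw [f.map_add, g.map_add, ih, f.map_negOne, g.map_negOne]

/-- The relation `y = f x` for the extension `f` of a homomorphism `g` of unit intervals: all
truncations of `y` are the images under `g` of those of `x`. -/
def Extends (g : MVMonoidalHom (UnitIntvl M) (UnitIntvl N)) (x : M) (y : N) : Prop :=
  ∀ k : ℤ, slice (y + intElt N k) = g.toFun (slice (x + intElt M k))

namespace Extends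

variable {g : MVMonoidalHom (UnitIntvl M) (UnitIntvl N)} {x x' : M} {y y' : N}

theorem eq (h : Extends g x y) (h' : Extends g x y') : y = y' :=
  eq_of_slice_eq fun k => by rw [h k, h' k]

theorem sup (h : Extends g x y) (h' : Extends g x' y') : Extends g (x ⊔ x') (y ⊔ y') := fun k => by
  rw [sup_add', sup_add', slice_sup, slice_sup, g.map_sup, h k, h' k]

theorem inf (h : Extends g x y) (h' : Extends g x' y') : Extends g (x ⊓ x') (y ⊓ y') := fun k => by
  rw [inf_add', inf_add', slice_inf, slice_inf, g.map_inf, h k, h' k]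

theorem add_unitIntvl (h : Extends g x y) (a : UnitIntvl M) :
    Extends g (x + a.1) (y + (g.toFun a).1) := fun k => by
  rw [add_right_comm, add_right_comm x, slice_add, slice_add, g.map_oplus, g.map_odot, h k,
    add_assoc, add_assoc x, ← intElt_add_one, ← intElt_add_one, h (k + 1)]

theorem add_negOne (h : Extends g x y) : Extends g (x + negOne) (y + negOne) := fun k => by
  rw [add_right_comm, add_right_comm x, add_assoc, add_assoc x, ← intElt_sub_one,
    ← intElt_sub_one, h (k - 1)]

variable (g) in
theorem zero : Extends g (0 : M) (0 : N) := fun k => by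
  rw [zero_add, zero_add]
  rcases le_or_gt k 0 with hk | hk
  · obtain ⟨n, rfl⟩ : ∃ n : ℕ, k = -n := ⟨k.natAbs, by omega⟩
    rw [slice_eq_zero (intElt_nonpos n), slice_eq_zero (intElt_nonpos n), g.map_zero]
  · obtain ⟨n, rfl⟩ : ∃ n : ℕ, k = n + 1 := ⟨(k - 1).natAbs, by omega⟩
    rw [slice_eq_one (one_le_intElt n), slice_eq_one (one_le_intElt n), g.map_one]

theorem add (h : Extends g x y) (h' : Extends g x' y') : Extends g (x + x') (y + y') := by
  have key : ∃ z, Extends g x' z ∧ Extends g (x + x') (y + z) := by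
    clear h'
    induction x' using induction_add with
    | zero => exact ⟨0, zero g, by rwa [add_zero, add_zero]⟩
    | add x' a ih =>
      obtain ⟨z, h1, h2⟩ := ih
      refine ⟨_, h1.add_unitIntvl a, ?_⟩
      rw [← add_assoc, ← add_assoc]
      exact h2.add_unitIntvl a
    | add_negOne x' ih =>
      obtain ⟨z, h1, h2⟩ := ih
      refine ⟨_, h1.add_negOne, ?_⟩
      rw [← add_assoc, ← add_assoc]
      exact h2.add_negOne
  obtain ⟨z, h1, h2⟩ := key
  rwa [h'.eq h1]

variable (g) in
theorem exists_extends (x : M) : ∃ y, Extends g x y := by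
  induction x using induction_add with
  | zero => exact ⟨0, zero g⟩
  | add x a ih =>
    obtain ⟨y, h⟩ := ih
    exact ⟨_, h.add_unitIntvl a⟩
  | add_negOne x ih =>
    obtain ⟨y, h⟩ := ih
    exact ⟨_, h.add_negOne⟩

variable (g) in
theorem unitIntvl (a : UnitIntvl M) : Extends g a.1 (g.toFun a).1 := by
  have h := (zero g).add_unitIntvl a
  rwa [zero_add, zero_add] at h

end Extends

theorem exists_hom_extending (g : MVMonoidalHom (UnitIntvl M) (UnitIntvl N)) :
    ∃ f : UnitalLMonoidHom M N, f.restrict = g := by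
  choose f hf using Extends.exists_extends g
  refine ⟨⟨f, fun x y => (hf _).eq ((hf x).add (hf y)), fun x y => (hf _).eq ((hf x).sup (hf y)),
    fun x y => (hf _).eq ((hf x).inf (hf y)), (hf _).eq (Extends.zero g), ?_, ?_⟩, ?_⟩
  · refine (hf _).eq ?_
    have h := Extends.unitIntvl g 1
    rwa [g.map_one] at h
  · refine (hf _).eq ?_
    have h := (Extends.zero g).add_negOne
    rwa [zero_add, zero_add] at h
  · apply MVMonoidalHom.ext
    funext a
    exact Subtype.ext ((hf a.1).eq (Extends.unitIntvl g a))

end UnitalLMonoid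

end Slices

/-! ### The unit interval functor is an equivalence -/

section UnitIntvlFunctor

/-- The isomorphism given by a bijective homomorphism of MV-monoidal algebras. -/
noncomputable def MVM.isoOfBijective {A B : MVM.{u}} (f : MVMonoidalHom A.carrier B.carrier)
    (hf : Function.Bijective f.toFun) : A ≅ B :=
  let e := Equiv.ofBijective f.toFun hf
  have he : ∀ x, f.toFun (e.symm x) = x := e.apply_symm_apply
  { hom := f
    inv := MVMonoidalHom.mk e.symm
      (fun x y => hf.1 (by simp only [f.map_oplus, he]))
      (fun x y => hf.1 (by simp only [f.map_odot, he]))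
      (fun x y => hf.1 (by simp only [f.map_sup, he]))
      (fun x y => hf.1 (by simp only [f.map_inf, he]))
      (hf.1 (by simp only [f.map_zero, he]))
      (hf.1 (by simp only [f.map_one, he]))
    hom_inv_id := MVMonoidalHom.ext (funext e.symm_apply_apply)
    inv_hom_id := MVMonoidalHom.ext (funext e.apply_symm_apply) }

instance unitIntvlFunctor_faithful : (unitIntvlFunctor.{u}).Faithful where
  map_injective h := UnitalLMonoid.hom_ext fun a =>
    congrArg Subtype.val (congrFun (congrArg MVMonoidalHom.toFun h) a)

instance unitIntvlFunctor_full : (unitIntvlFunctor.{u}).Full where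
  map_surjective g := UnitalLMonoid.exists_hom_extending g

instance unitIntvlFunctor_essSurj : (unitIntvlFunctor.{u}).EssSurj where
  mem_essImage A := ⟨⟨GoodSeq A.carrier⟩,
    ⟨MVM.isoOfBijective (A := unitIntvlFunctor.obj ⟨GoodSeq A.carrier⟩) (GoodSeq.unitIntvlHom _)
      GoodSeq.unitIntvlHom_bijective⟩⟩

instance unitIntvlFunctor_isEquivalence : (unitIntvlFunctor.{u}).IsEquivalence where

end UnitIntvlFunctor

/-! ### The reduct of an MV-algebra -/

section MVAlgebra

namespace MVAlgebra

variable {A : Type u} [MVAlgebra A]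

/-- The derived unit `¬0` of an MV-algebra. -/
@[reducible]
def derivedOne (A : Type u) [MVAlgebra A] : One A := ⟨0ᶜ⟩

/-- The derived product `¬(¬x ⊕ ¬y)` of an MV-algebra. -/
@[reducible]
def derivedODot (A : Type u) [MVAlgebra A] : ODot A := ⟨fun x y => (xᶜ ⊕ₘ yᶜ)ᶜ⟩

attribute [local instance] derivedOne derivedODot

theorem odot_def (x y : A) : x ⊙ₘ y = (xᶜ ⊕ₘ yᶜ)ᶜ := rfl

theorem compl_one : (1 : A)ᶜ = 0 := compl_compl' 0

theorem compl_oplus (x y : A) : (x ⊕ₘ y)ᶜ = xᶜ ⊙ₘ yᶜ := by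
  rw [odot_def, compl_compl', compl_compl']

theorem compl_odot (x y : A) : (x ⊙ₘ y)ᶜ = xᶜ ⊕ₘ yᶜ := compl_compl' _

theorem compl_injective : Function.Injective (fun x : A => xᶜ) := fun x y h => by
  rw [← compl_compl' x, ← compl_compl' y]
  exact congrArg _ h

theorem zero_oplus (x : A) : 0 ⊕ₘ x = x := by rw [oplus_comm, oplus_zero]

theorem one_oplus (x : A) : 1 ⊕ₘ x = 1 := compl_zero_oplus x

theorem oplus_one (x : A) : x ⊕ₘ 1 = 1 := by rw [oplus_comm, one_oplus]

theorem odot_comm (x y : A) : x ⊙ₘ y = y ⊙ₘ x := by rw [odot_def, odot_def, oplus_comm]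

theorem odot_assoc (x y z : A) : x ⊙ₘ y ⊙ₘ z = x ⊙ₘ (y ⊙ₘ z) := by
  rw [odot_def (x ⊙ₘ y), compl_odot, odot_def x (y ⊙ₘ z), compl_odot, oplus_assoc]

theorem odot_one (x : A) : x ⊙ₘ 1 = x := by
  rw [odot_def, compl_one, oplus_zero, compl_compl']

theorem compl_oplus_self (x : A) : xᶜ ⊕ₘ x = 1 := by
  have h := lukasiewicz x 1
  rw [oplus_one, compl_one, zero_oplus] at h
  exact h.symm

theorem odot_compl_self (x : A) : x ⊙ₘ xᶜ = 0 := by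
  rw [odot_def, compl_compl', compl_oplus_self, compl_one]

theorem exists_oplus_of_compl_oplus_eq_one {x y : A} (h : xᶜ ⊕ₘ y = 1) : ∃ z, y = x ⊕ₘ z := by
  have h' := lukasiewicz x y
  rw [h, compl_one, zero_oplus, oplus_comm _ x] at h'
  exact ⟨_, h'⟩

theorem compl_oplus_oplus (x z : A) : xᶜ ⊕ₘ (x ⊕ₘ z) = 1 := by
  rw [← oplus_assoc, compl_oplus_self, one_oplus]

/-- The natural order of an MV-algebra: `x ≤ y` means `¬x ⊕ y = 1`. -/
@[reducible]
def derivedPartialOrder (A : Type u) [MVAlgebra A] : PartialOrder A where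
  le x y := xᶜ ⊕ₘ y = 1
  le_refl := compl_oplus_self
  le_trans x y z hxy hyz := by
    obtain ⟨v, rfl⟩ := exists_oplus_of_compl_oplus_eq_one hxy
    obtain ⟨w, rfl⟩ := exists_oplus_of_compl_oplus_eq_one hyz
    rw [oplus_assoc, compl_oplus_oplus]
  le_antisymm x y hxy hyx := by
    have h := lukasiewicz x y
    rw [hxy, hyx, compl_one, zero_oplus, zero_oplus] at h
    exact h.symm

attribute [local instance] derivedPartialOrder

theorem le_iff {x y : A} : x ≤ y ↔ xᶜ ⊕ₘ y = 1 := Iff.rfl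

theorem le_oplus_right (x y : A) : x ≤ x ⊕ₘ y := compl_oplus_oplus x y

theorem le_oplus_left (x y : A) : y ≤ x ⊕ₘ y := by
  rw [oplus_comm]
  exact le_oplus_right y x

theorem zero_le (x : A) : 0 ≤ x := one_oplus x

theorem oplus_le_oplus {x x' y y' : A} (hx : x ≤ x') (hy : y ≤ y') : x ⊕ₘ y ≤ x' ⊕ₘ y' := by
  obtain ⟨v, rfl⟩ := exists_oplus_of_compl_oplus_eq_one hx
  obtain ⟨w, rfl⟩ := exists_oplus_of_compl_oplus_eq_one hy
  have e : x ⊕ₘ v ⊕ₘ (y ⊕ₘ w) = x ⊕ₘ y ⊕ₘ (v ⊕ₘ w) := by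
    rw [oplus_assoc, oplus_assoc, ← oplus_assoc v, oplus_comm v, oplus_assoc y]
  rw [e]
  exact le_oplus_right _ _

theorem compl_le_compl {x y : A} (h : x ≤ y) : yᶜ ≤ xᶜ := by
  rw [le_iff, compl_compl', oplus_comm]
  exact h

theorem compl_le_compl_iff {x y : A} : yᶜ ≤ xᶜ ↔ x ≤ y :=
  ⟨fun h => by simpa only [compl_compl'] using compl_le_compl h, compl_le_compl⟩

theorem odot_le_odot {x x' y y' : A} (hx : x ≤ x') (hy : y ≤ y') : x ⊙ₘ y ≤ x' ⊙ₘ y' :=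
  compl_le_compl (oplus_le_oplus (compl_le_compl hx) (compl_le_compl hy))

theorem odot_le_left (x y : A) : x ⊙ₘ y ≤ x := by
  rw [← compl_le_compl_iff, compl_odot]
  exact le_oplus_right _ _

theorem odot_le_right (x y : A) : x ⊙ₘ y ≤ y := by
  rw [odot_comm]
  exact odot_le_left y x

/-- The residuation law. -/
theorem odot_le_iff {x y z : A} : x ⊙ₘ y ≤ z ↔ x ≤ yᶜ ⊕ₘ z := by
  rw [le_iff, le_iff, compl_odot, oplus_assoc]

theorem odot_oplus_self_comm (x y : A) : (x ⊙ₘ yᶜ) ⊕ₘ y = (y ⊙ₘ xᶜ) ⊕ₘ x := by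
  rw [odot_def, odot_def, compl_compl', compl_compl', lukasiewicz]

theorem odot_oplus_self_of_le {x y : A} (h : x ≤ y) : (x ⊙ₘ yᶜ) ⊕ₘ y = y := by
  rw [odot_def, compl_compl', le_iff.1 h, compl_one, zero_oplus]

theorem odot_compl_oplus_eq (x y : A) : x ⊙ₘ (xᶜ ⊕ₘ y) = ((xᶜ ⊙ₘ yᶜᶜ) ⊕ₘ yᶜ)ᶜ := by
  rw [odot_oplus_self_comm, compl_oplus, compl_odot, odot_comm, compl_compl' x,
    compl_compl' y, oplus_comm y]

/-- The lattice of an MV-algebra, with `x ∨ y = (x ⊙ ¬y) ⊕ y` and `x ∧ y = x ⊙ (¬x ⊕ y)`. -/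
@[reducible]
def derivedLattice (A : Type u) [MVAlgebra A] : Lattice A where
  __ := derivedPartialOrder A
  sup x y := (x ⊙ₘ yᶜ) ⊕ₘ y
  inf x y := x ⊙ₘ (xᶜ ⊕ₘ y)
  le_sup_left x y := by
    rw [odot_oplus_self_comm]
    exact le_oplus_left _ _
  le_sup_right x y := le_oplus_left _ _
  sup_le x y z hx hy := by
    have h : (x ⊙ₘ yᶜ) ⊕ₘ y ≤ (z ⊙ₘ yᶜ) ⊕ₘ y := oplus_le_oplus (odot_le_odot hx le_rfl) le_rfl
    rwa [odot_oplus_self_comm z, odot_oplus_self_of_le hy] at h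
  inf_le_left x y := odot_le_left _ _
  inf_le_right x y := by
    rw [odot_compl_oplus_eq, ← compl_le_compl_iff, compl_compl']
    exact le_oplus_left _ _
  le_inf x y z hx hy := by
    have h : (yᶜ ⊙ₘ zᶜᶜ) ⊕ₘ zᶜ ≤ (xᶜ ⊙ₘ zᶜᶜ) ⊕ₘ zᶜ :=
      oplus_le_oplus (odot_le_odot (compl_le_compl hx) le_rfl) le_rfl
    rw [odot_oplus_self_comm xᶜ, odot_oplus_self_of_le (compl_le_compl hy)] at h
    rw [odot_compl_oplus_eq, ← compl_le_compl_iff, compl_compl']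
    exact h

attribute [local instance] derivedLattice

theorem sup_def (x y : A) : x ⊔ y = (x ⊙ₘ yᶜ) ⊕ₘ y := rfl

theorem inf_def (x y : A) : x ⊓ y = x ⊙ₘ (xᶜ ⊕ₘ y) := rfl

theorem compl_inf (x y : A) : (x ⊓ y)ᶜ = xᶜ ⊔ yᶜ := by
  rw [inf_def, odot_compl_oplus_eq, compl_compl', sup_def]

theorem compl_sup (x y : A) : (x ⊔ y)ᶜ = xᶜ ⊓ yᶜ :=
  compl_injective (by
    beta_reduce
    rw [compl_inf, compl_compl', compl_compl', compl_compl'])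

theorem odot_sup (x y z : A) : x ⊙ₘ (y ⊔ z) = (x ⊙ₘ y) ⊔ (x ⊙ₘ z) := by
  refine le_antisymm ?_
    (sup_le (odot_le_odot le_rfl le_sup_left) (odot_le_odot le_rfl le_sup_right))
  rw [odot_comm, odot_le_iff]
  refine sup_le ?_ ?_
  · rw [← odot_le_iff, odot_comm]
    exact le_sup_left
  · rw [← odot_le_iff, odot_comm]
    exact le_sup_right

theorem oplus_inf (x y z : A) : x ⊕ₘ (y ⊓ z) = (x ⊕ₘ y) ⊓ (x ⊕ₘ z) :=
  compl_injective (by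
    beta_reduce
    rw [compl_oplus, compl_inf, odot_sup, compl_inf, compl_oplus, compl_oplus])

theorem inf_sup_le (x y z : A) : x ⊓ (y ⊔ z) ≤ (x ⊓ y) ⊔ (x ⊓ z) := by
  rw [inf_comm, inf_def, odot_comm, odot_sup]
  refine sup_le_sup ?_ ?_
  · rw [inf_comm, inf_def, odot_comm]
    exact odot_le_odot le_rfl (oplus_le_oplus (compl_le_compl le_sup_left) le_rfl)
  · rw [inf_comm, inf_def, odot_comm]
    exact odot_le_odot le_rfl (oplus_le_oplus (compl_le_compl le_sup_right) le_rfl)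

/-- The distributive lattice of an MV-algebra. -/
@[reducible]
def derivedDistribLattice (A : Type u) [MVAlgebra A] : DistribLattice A :=
  DistribLattice.ofInfSupLe inf_sup_le

theorem odot_compl_oplus_le (x y : A) : x ⊙ₘ (xᶜ ⊕ₘ y) ≤ y := (inf_le_right : x ⊓ y ≤ y)

theorem oplus_odot_compl (x y : A) : (x ⊕ₘ y) ⊙ₘ yᶜ = x ⊓ yᶜ := by
  rw [_root_.inf_comm, inf_def, compl_compl', odot_comm, oplus_comm]

/-- The two truncated differences are disjoint. -/
theorem odot_compl_inf_odot_compl (x y : A) : (x ⊙ₘ yᶜ) ⊓ (y ⊙ₘ xᶜ) = 0 := by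
  refine le_antisymm ?_ (zero_le _)
  -- With `w = y ⊙ ¬x` and `v = y ⊕ w` the meet is `¬y ⊙ (x ∧ v) = ¬y ⊙ v ⊙ (¬v ⊕ x)`, where
  -- `¬y ⊙ v ≤ w` and `¬x ⊙ (¬v ⊕ x) ≤ ¬y`; so it lies below `y ⊙ ¬y = 0`.
  have e : (x ⊙ₘ yᶜ) ⊓ (y ⊙ₘ xᶜ) = yᶜ ⊙ₘ (x ⊓ (y ⊕ₘ (y ⊙ₘ xᶜ))) := by
    rw [inf_def, inf_def, compl_odot, compl_compl', oplus_assoc, odot_comm x, odot_assoc]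
  rw [e, _root_.inf_comm, inf_def, ← odot_assoc]
  have h1 : yᶜ ⊙ₘ (y ⊕ₘ (y ⊙ₘ xᶜ)) ≤ y ⊙ₘ xᶜ := by
    have h := odot_compl_oplus_le yᶜ (y ⊙ₘ xᶜ)
    rwa [compl_compl'] at h
  refine (odot_le_odot h1 le_rfl).trans ?_
  have h2 : xᶜ ⊙ₘ ((y ⊕ₘ (y ⊙ₘ xᶜ))ᶜ ⊕ₘ x) ≤ yᶜ := by
    rw [compl_oplus, compl_odot, compl_compl', oplus_comm _ x]
    have h := odot_compl_oplus_le xᶜ (yᶜ ⊙ₘ (yᶜ ⊕ₘ x))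
    rw [compl_compl'] at h
    exact h.trans (odot_le_left _ _)
  rw [odot_assoc]
  refine (odot_le_odot le_rfl h2).trans ?_
  rw [odot_compl_self]

/-- Prelinearity. -/
theorem compl_oplus_sup_compl_oplus (x y : A) : (xᶜ ⊕ₘ y) ⊔ (yᶜ ⊕ₘ x) = 1 :=
  compl_injective (by
    beta_reduce
    rw [compl_sup, compl_oplus, compl_oplus, compl_compl', compl_compl', compl_one,
      odot_compl_inf_odot_compl])

theorem odot_inf (x y z : A) : x ⊙ₘ (y ⊓ z) = (x ⊙ₘ y) ⊓ (x ⊙ₘ z) := by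
  refine le_antisymm
    (le_inf (odot_le_odot le_rfl inf_le_left) (odot_le_odot le_rfl inf_le_right)) ?_
  rw [← odot_one ((x ⊙ₘ y) ⊓ (x ⊙ₘ z)), ← compl_oplus_sup_compl_oplus y z, odot_sup]
  refine sup_le ?_ ?_
  · refine (odot_le_odot inf_le_left le_rfl).trans ?_
    rw [odot_assoc, ← inf_def]
  · refine (odot_le_odot inf_le_right le_rfl).trans ?_
    rw [odot_assoc, ← inf_def, _root_.inf_comm]

theorem oplus_sup (x y z : A) : x ⊕ₘ (y ⊔ z) = (x ⊕ₘ y) ⊔ (x ⊕ₘ z) :=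
  compl_injective (by
    beta_reduce
    rw [compl_oplus, compl_sup, odot_inf, compl_sup, compl_oplus, compl_oplus])

theorem odot_odot_oplus (x y : A) : (x ⊙ₘ y) ⊙ₘ (x ⊕ₘ y) = x ⊙ₘ y := by
  refine le_antisymm (odot_le_left _ _) ?_
  have h := odot_compl_inf_odot_compl x yᶜ
  rw [compl_compl', inf_def] at h
  have h' : (x ⊙ₘ y) ≤ ((x ⊙ₘ y)ᶜ ⊕ₘ (yᶜ ⊙ₘ xᶜ))ᶜ := by
    rw [le_iff, ← compl_odot, h]
    rfl
  rwa [compl_oplus, compl_compl', compl_odot, compl_compl', compl_compl', oplus_comm y] at h'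

theorem odot_eq_of_le {s t r : A} (h : t ⊙ₘ s = t) (hr : r ≤ t) : s ⊙ₘ r = r := by
  have e : t ⊙ₘ (tᶜ ⊕ₘ r) = r := inf_eq_right.2 hr
  rw [← e, ← odot_assoc, odot_comm s, h]

/-- The axiom `ax6` of MV-monoidal algebras. -/
theorem odot_oplus_eq_sup (x y z : A) :
    (x ⊙ₘ y) ⊕ₘ z = ((x ⊕ₘ y) ⊙ₘ ((x ⊙ₘ y) ⊕ₘ z)) ⊔ z := by
  have e : ∀ w : A, ((w ⊕ₘ z) ⊙ₘ zᶜ) ⊕ₘ z = w ⊕ₘ z := fun w =>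
    (sup_eq_left.2 (le_oplus_left w z) : (w ⊕ₘ z) ⊔ z = w ⊕ₘ z)
  rw [sup_def, odot_assoc, oplus_odot_compl, odot_eq_of_le (odot_odot_oplus x y) inf_le_left,
    ← oplus_odot_compl, e]

theorem oplus_odot_eq_inf (x y z : A) :
    (x ⊕ₘ y) ⊙ₘ z = ((x ⊙ₘ y) ⊕ₘ ((x ⊕ₘ y) ⊙ₘ z)) ⊓ z :=
  compl_injective (by
    beta_reduce
    simp only [compl_inf, compl_oplus, compl_odot]
    exact odot_oplus_eq_sup xᶜ yᶜ zᶜ)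

/-- Both sides are the truncation of `x + y + z - 1`. -/
theorem oplus_odot_eq_odot_oplus (x y z : A) :
    (x ⊕ₘ y) ⊙ₘ ((x ⊙ₘ y) ⊕ₘ z) = (x ⊙ₘ y) ⊕ₘ ((x ⊕ₘ y) ⊙ₘ z) := by
  apply le_antisymm
  · have h : (x ⊕ₘ y) ⊙ₘ ((x ⊙ₘ y) ⊕ₘ z) ⊙ₘ (x ⊙ₘ y)ᶜ ≤ (x ⊕ₘ y) ⊙ₘ z := by
      rw [odot_assoc, oplus_comm (x ⊙ₘ y), oplus_odot_compl]
      exact odot_le_odot le_rfl inf_le_left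
    rw [odot_le_iff, compl_compl'] at h
    exact h
  · rw [odot_oplus_eq_sup x y ((x ⊕ₘ y) ⊙ₘ z)]
    exact sup_le (odot_le_odot le_rfl (oplus_le_oplus le_rfl (odot_le_right _ _)))
      (odot_le_odot le_rfl (le_oplus_left _ _))

theorem odot_oplus_sup_rotate (x y z : A) :
    ((y ⊙ₘ z) ⊕ₘ ((y ⊕ₘ z) ⊙ₘ x)) ⊔ z = (x ⊙ₘ y) ⊕ₘ z := by
  have e : ∀ w : A, ((w ⊕ₘ z) ⊙ₘ zᶜ) ⊕ₘ z = w ⊕ₘ z := fun w =>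
    (sup_eq_left.2 (le_oplus_left w z) : (w ⊕ₘ z) ⊔ z = w ⊕ₘ z)
  rw [← oplus_odot_eq_odot_oplus, sup_def, ← e (x ⊙ₘ y), oplus_odot_compl]
  congr 1
  calc (y ⊕ₘ z) ⊙ₘ ((y ⊙ₘ z) ⊕ₘ x) ⊙ₘ zᶜ
      = (y ⊕ₘ z) ⊙ₘ zᶜ ⊙ₘ ((y ⊙ₘ z) ⊕ₘ x) := by
        rw [odot_assoc, odot_comm _ zᶜ, ← odot_assoc]
    _ = y ⊙ₘ ((x ⊕ₘ (y ⊙ₘ z)) ⊙ₘ (y ⊙ₘ z)ᶜ) := by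
        have h : (y ⊕ₘ z) ⊙ₘ zᶜ = y ⊙ₘ (y ⊙ₘ z)ᶜ := by
          rw [oplus_odot_compl, inf_def, compl_odot]
        rw [h, odot_assoc, odot_comm (y ⊙ₘ z)ᶜ, oplus_comm x]
    _ = (y ⊙ₘ x) ⊓ (y ⊓ zᶜ) := by
        rw [oplus_odot_compl, odot_inf, compl_odot, ← inf_def]
    _ = (x ⊙ₘ y) ⊓ zᶜ := by
        rw [← _root_.inf_assoc, inf_eq_left.2 (odot_le_left y x), odot_comm]

theorem odot_oplus_inf_rotate (x y z : A) :
    ((y ⊙ₘ z) ⊕ₘ ((y ⊕ₘ z) ⊙ₘ x)) ⊓ z = (x ⊕ₘ y) ⊙ₘ z :=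
  compl_injective (by
    beta_reduce
    rw [← oplus_odot_eq_odot_oplus]
    have h := odot_oplus_sup_rotate xᶜ yᶜ zᶜ
    simp only [compl_inf, compl_oplus, compl_odot] at h ⊢
    exact h)

/-- In a distributive lattice an element is determined by its join and meet with `z`. For the
truncation of `x + y + z - 1` these are symmetric in the required way. -/
theorem odot_oplus_rotate (x y z : A) :
    (x ⊙ₘ y) ⊕ₘ ((x ⊕ₘ y) ⊙ₘ z) = (y ⊙ₘ z) ⊕ₘ ((y ⊕ₘ z) ⊙ₘ x) := by
  let := derivedDistribLattice A
  refine eq_of_inf_eq_sup_eq (a := z) ?_ ?_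
  · exact (oplus_odot_eq_inf x y z).symm.trans (odot_oplus_inf_rotate x y z).symm
  · have h := odot_oplus_eq_sup x y z
    rw [oplus_odot_eq_odot_oplus] at h
    exact h.symm.trans (odot_oplus_sup_rotate x y z).symm

theorem oplus_odot_axiom (x y z : A) :
    (x ⊕ₘ y) ⊙ₘ ((x ⊙ₘ y) ⊕ₘ z) = (x ⊙ₘ (y ⊕ₘ z)) ⊕ₘ (y ⊙ₘ z) := by
  rw [oplus_odot_eq_odot_oplus, odot_oplus_rotate, oplus_comm, odot_comm x]

theorem odot_oplus_axiom (x y z : A) :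
    (x ⊙ₘ y) ⊕ₘ ((x ⊕ₘ y) ⊙ₘ z) = (x ⊕ₘ (y ⊙ₘ z)) ⊙ₘ (y ⊕ₘ z) := by
  rw [odot_oplus_rotate, ← oplus_odot_eq_odot_oplus, odot_comm, oplus_comm x]

theorem reductIsMVMonoidal (A : Type u) [MVAlgebra A] : ReductIsMVMonoidal A :=
  letI := derivedDistribLattice A
  @IsMVMonoidal.mk A (derivedOps A)
    (fun x y : A => _root_.sup_comm x y)
    (fun x y z : A => _root_.sup_assoc x y z)
    (fun x y : A => _root_.inf_comm x y)
    (fun x y z : A => _root_.inf_assoc x y z)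
    (fun x y : A => _root_.sup_inf_self (a := x) (b := y))
    (fun x y : A => _root_.inf_sup_self (a := x) (b := y))
    (fun x y z : A => _root_.inf_sup_left x y z)
    oplus_comm oplus_assoc oplus_zero odot_comm odot_assoc odot_one oplus_sup oplus_inf
    odot_sup odot_inf oplus_odot_axiom odot_oplus_axiom odot_oplus_eq_sup oplus_odot_eq_inf

/-- The complement of `x` is characterised by two equations in the signature of the reduct. -/
theorem eq_compl_of_oplus_of_odot {x y : A} (h1 : x ⊕ₘ y = 0ᶜ) (h0 : (xᶜ ⊕ₘ yᶜ)ᶜ = 0) :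
    y = xᶜ := by
  apply le_antisymm
  · rw [le_iff, oplus_comm]
    exact compl_injective (h0.trans compl_one.symm)
  · rw [le_iff, compl_compl']
    exact h1

end MVAlgebra

end MVAlgebra

/-! ### The restriction to Mundici's equivalence -/

section Mundici

instance ulgReduct_faithful : (ulgReduct.{u}).Faithful where
  map_injective h := UnitalLGroupHom.ext (congrArg UnitalLMonoidHom.toFun h)

instance ulgReduct_full : (ulgReduct.{u}).Full where
  map_surjective {G H} g := by
    let := UnitalLGroup.toUnitalLMonoid G.carrier
    let := UnitalLGroup.toUnitalLMonoid H.carrier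
    let g' : UnitalLMonoidHom G.carrier H.carrier := g
    refine ⟨⟨g'.toFun, g'.map_add, g'.map_sup, g'.map_inf, g'.map_zero, fun x => ?_, g'.map_one⟩,
      rfl⟩
    have h := g'.map_add (-x) x
    rw [neg_add_cancel, g'.map_zero] at h
    exact eq_neg_of_add_eq_zero_left h.symm

theorem mvReduct_faithful (h : ∀ A : MV.{u}, MVAlgebra.ReductIsMVMonoidal A.carrier) :
    (mvReduct h).Faithful where
  map_injective e := MVAlgebraHom.ext (congrArg MVMonoidalHom.toFun e)

theorem mvReduct_full (h : ∀ A : MV.{u}, MVAlgebra.ReductIsMVMonoidal A.carrier) :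
    (mvReduct h).Full where
  map_surjective {A B} g := by
    let := MVAlgebra.derivedOps A.carrier
    let := MVAlgebra.derivedOps B.carrier
    let g' : MVMonoidalHom A.carrier B.carrier := g
    refine ⟨⟨g'.toFun, g'.map_oplus, fun x => ?_, g'.map_zero⟩, rfl⟩
    refine MVAlgebra.eq_compl_of_oplus_of_odot ?_ ?_
    · refine (g'.map_oplus x xᶜ).symm.trans ?_
      have e : x ⊕ₘ xᶜ = 0ᶜ := (MVAlgebra.oplus_comm _ _).trans (MVAlgebra.compl_oplus_self x)
      exact (congrArg g'.toFun e).trans g'.map_one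
    · refine (g'.map_odot x xᶜ).symm.trans ?_
      exact (congrArg g'.toFun (MVAlgebra.odot_compl_self x)).trans g'.map_zero

/-- The two structures of MV-monoidal algebra on the unit interval of a unital Abelian
lattice-ordered group, the one of its reduct and the one derived from its MV-algebra, agree. -/
def unitIntvlReductHom (G : Type u) [UnitalLGroup G] :
    @MVMonoidalHom (UnitIntvl G) (UnitIntvl G)
      (@UnitalLMonoid.unitIntvlOps G (UnitalLGroup.toUnitalLMonoid G))
      (MVAlgebra.derivedOps (UnitIntvl G)) :=
  letI := UnitalLGroup.toUnitalLMonoid G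
  have hsub : ∀ a b : G, 1 - a ⊓ b = (1 - a) ⊔ (1 - b) := fun a b => by
    rw [sub_eq_add_neg, neg_inf, UnitalLGroup.add_sup', ← sub_eq_add_neg, ← sub_eq_add_neg]
  @MVMonoidalHom.mk _ _ _ (MVAlgebra.derivedOps (UnitIntvl G)) (fun x => x)
    (fun _ _ => rfl)
    (fun x y => Subtype.ext (by
      change (x.1 + y.1 + -1) ⊔ 0 = 1 - ((1 - x.1) + (1 - y.1)) ⊓ 1
      rw [hsub, sub_self]
      congr 1
      abel))
    (fun x y => Subtype.ext (by
      change x.1 ⊔ y.1 = (1 - ((1 - x.1) + (1 - (1 - y.1))) ⊓ 1 + y.1) ⊓ 1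
      rw [sub_sub_cancel, UnitalLGroup.lukasiewicz_eq_sup x.2.2 y.2.2]))
    (fun x y => Subtype.ext (by
      change x.1 ⊓ y.1 = 1 - ((1 - x.1) + (1 - ((1 - x.1) + y.1) ⊓ 1)) ⊓ 1
      have h := UnitalLGroup.lukasiewicz_eq_sup (x := 1 - y.1) (y := 1 - x.1)
        (sub_le_self 1 y.2.1) (sub_le_self 1 x.2.1)
      rw [sub_sub_cancel, add_comm y.1, add_comm _ (1 - x.1), sup_comm, ← hsub] at h
      rw [h, sub_sub_cancel]))
    rfl
    (Subtype.ext (sub_zero (1 : G)).symm)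

/-- The identity maps form a natural isomorphism between the unit interval of the reduct and the
reduct of the unit interval. -/
noncomputable def reductUnitIntvlIso
    (h : ∀ A : MV.{u}, MVAlgebra.ReductIsMVMonoidal A.carrier) :
    ulgReduct.{u} ⋙ unitIntvlFunctor.{u} ≅ mundiciFunctor.{u} ⋙ mvReduct h :=
  NatIso.ofComponents (fun G => MVM.isoOfBijective
    (A := (ulgReduct ⋙ unitIntvlFunctor).obj G) (B := (mundiciFunctor ⋙ mvReduct h).obj G)
    (unitIntvlReductHom G.carrier) Function.bijective_id) fun _ => rfl

theorem reductUnitIntvlIso_hom_app (h : ∀ A : MV.{u}, MVAlgebra.ReductIsMVMonoidal A.carrier)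
    (G : ULG.{u}) (x : UnitIntvl G.carrier) :
    MVMonoidalHom.toFun ((reductUnitIntvlIso h).hom.app G) x = x := rfl

/-- A unital commutative lattice-ordered monoid in which every element of the unit interval has a
negative is the reduct of a group, because the unit interval and `-1` generate it. -/
theorem mem_essImage_ulgReduct (M : ULM.{u})
    (hM : ∀ a : UnitIntvl M.carrier, ∃ y, y + a.1 = 0) : ulgReduct.essImage M := by
  have hneg : ∀ x : M.carrier, ∃ y, y + x = 0 := by
    intro x
    induction x using UnitalLMonoid.induction_add with
    | zero => exact ⟨0, add_zero 0⟩
    | add x a ih =>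
      obtain ⟨y, hy⟩ := ih
      obtain ⟨b, hb⟩ := hM a
      exact ⟨y + b, by rw [add_add_add_comm, hy, hb, add_zero]⟩
    | add_negOne x ih =>
      obtain ⟨y, hy⟩ := ih
      exact ⟨y + 1, by rw [add_add_add_comm, hy, UnitalLMonoid.one_add_negOne, add_zero]⟩
  choose neg hneg using hneg
  let : Neg M.carrier := ⟨neg⟩
  let : AddCommGroup M.carrier :=
    { (inferInstance : AddCommMonoid M.carrier) with
      zsmul := zsmulRec fun n x => n • x
      zsmul_zero' := zero_nsmul
      zsmul_succ' := fun n x => succ_nsmul x n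
      neg_add_cancel := hneg }
  let : UnitalLGroup M.carrier :=
    { (inferInstance : DistribLattice M.carrier), (inferInstance : AddCommGroup M.carrier) with
      one := 1
      add_sup' := UnitalLMonoid.add_sup'
      add_inf' := UnitalLMonoid.add_inf'
      zero_le_one' := UnitalLMonoid.zero_le_one'
      bounded := fun x => (UnitalLMonoid.bounded x).imp fun n h => h.2 }
  have h1 : (-1 : M.carrier) = UnitalLMonoid.negOne :=
    (eq_neg_of_add_eq_zero_left UnitalLMonoid.negOne_add_one).symm
  refine ⟨⟨M.carrier⟩, ⟨?_⟩⟩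
  exact
    { hom := @UnitalLMonoidHom.mk M.carrier M.carrier (UnitalLGroup.toUnitalLMonoid M.carrier) _
        (fun x => x) (fun _ _ => rfl) (fun _ _ => rfl) (fun _ _ => rfl) rfl rfl h1
      inv := @UnitalLMonoidHom.mk M.carrier M.carrier _ (UnitalLGroup.toUnitalLMonoid M.carrier)
        (fun x => x) (fun _ _ => rfl) (fun _ _ => rfl) (fun _ _ => rfl) rfl rfl h1.symm
      hom_inv_id := rfl
      inv_hom_id := rfl }

/-- If the unit interval of `M` is the reduct of an MV-algebra, then `a + ¬a = 1` in `M`. -/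
theorem exists_add_eq_zero_of_iso (h : ∀ A : MV.{u}, MVAlgebra.ReductIsMVMonoidal A.carrier)
    {M : ULM.{u}} {A : MV.{u}} (i : unitIntvlFunctor.obj M ≅ (mvReduct h).obj A)
    (a : UnitIntvl M.carrier) : ∃ y, y + a.1 = 0 := by
  let := MVAlgebra.derivedOps A.carrier
  let f : MVMonoidalHom (UnitIntvl M.carrier) A.carrier := i.hom
  let g : MVMonoidalHom A.carrier (UnitIntvl M.carrier) := i.inv
  have hgf : g.toFun (f.toFun a) = a :=
    congrFun (congrArg MVMonoidalHom.toFun i.hom_inv_id) a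
  have e1 : a ⊕ₘ g.toFun (f.toFun a)ᶜ = 1 := by
    refine Eq.trans ?_ g.map_one
    refine Eq.trans ?_ (congrArg g.toFun
      ((MVAlgebra.oplus_comm _ _).trans (MVAlgebra.compl_oplus_self (f.toFun a))))
    refine Eq.trans ?_ (g.map_oplus _ _).symm
    rw [hgf]
  have e0 : a ⊙ₘ g.toFun (f.toFun a)ᶜ = 0 := by
    refine Eq.trans ?_ g.map_zero
    refine Eq.trans ?_ (congrArg g.toFun (MVAlgebra.odot_compl_self (f.toFun a)))
    refine Eq.trans ?_ (g.map_odot _ _).symm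
    rw [hgf]
  have e := UnitalLMonoid.oplus_add_odot a (g.toFun (f.toFun a)ᶜ)
  rw [e1, e0, UnitalLMonoid.val_one, UnitalLMonoid.val_zero, add_zero] at e
  exact ⟨UnitalLMonoid.negOne + (g.toFun (f.toFun a)ᶜ).1, by
    rw [add_assoc, add_comm _ a.1, ← e, UnitalLMonoid.negOne_add_one]⟩

theorem mundiciFunctor_isEquivalence : (mundiciFunctor.{u}).IsEquivalence := by
  have h : ∀ A : MV.{u}, MVAlgebra.ReductIsMVMonoidal A.carrier :=
    fun A => MVAlgebra.reductIsMVMonoidal A.carrier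
  have := mvReduct_faithful h
  have := mvReduct_full h
  refine ⟨?_, ?_, ⟨fun A => ?_⟩⟩
  · have := Functor.Faithful.of_iso (reductUnitIntvlIso h)
    exact Functor.Faithful.of_comp mundiciFunctor (mvReduct h)
  · exact Functor.Full.of_comp_faithful_iso (reductUnitIntvlIso h).symm
  · let M := unitIntvlFunctor.objPreimage ((mvReduct h).obj A)
    let i : unitIntvlFunctor.obj M ≅ (mvReduct h).obj A := unitIntvlFunctor.objObjPreimageIso _
    obtain ⟨G, ⟨j⟩⟩ := mem_essImage_ulgReduct M (exists_add_eq_zero_of_iso h i)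
    exact ⟨G, ⟨(mvReduct h).preimageIso
      ((reductUnitIntvlIso h).symm.app G ≪≫ unitIntvlFunctor.mapIso j ≪≫ i)⟩⟩

end Mundici

theorem theoremt :
    (unitIntvlFunctor.{u}).IsEquivalence ∧
    (ulgReduct.{u}).Full ∧ (ulgReduct.{u}).Faithful ∧
    ∃ h : ∀ A : MV.{u}, MVAlgebra.ReductIsMVMonoidal A.carrier,
      (mvReduct h).Full ∧ (mvReduct h).Faithful ∧
      (∃ α : ulgReduct.{u} ⋙ unitIntvlFunctor.{u} ≅ mundiciFunctor.{u} ⋙ mvReduct h,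
        ∀ (G : ULG.{u}) (x : UnitIntvl G.carrier),
          MVMonoidalHom.toFun (α.hom.app G) x = x) ∧
      (mundiciFunctor.{u}).IsEquivalence :=
  have h : ∀ A : MV.{u}, MVAlgebra.ReductIsMVMonoidal A.carrier :=
    fun A => MVAlgebra.reductIsMVMonoidal A.carrier
  ⟨inferInstance, inferInstance, inferInstance, h, mvReduct_full h, mvReduct_faithful h,
    ⟨reductUnitIntvlIso h, reductUnitIntvlIso_hom_app h⟩, mundiciFunctor_isEquivalence⟩
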